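/- **Setting.** Label the nodes of the Dynkin diagram of $E_6^{(1)}$ by $I=\{0,1,\dots,6\}$, with edges $1-2-3-4-5$, $3-6$, $6-0$; write $a\sim b$ for adjacent nodes, let $(C_{ab})$ be the Cartan matrix ($C_{aa}=2$, $C_{ab}=-1$ if $a\sim b$, and $0$ otherwise), and put $I_0=\{1,\dots,6\}$. Let $\overline\Lambda_a$ and $\alpha_a=\sum_{b\in I_0}C_{ab}\overline\Lambda_b$ $(a\in I_0)$ be the fundamental weights and simple roots of $E_6$, $\overline P^+=\bigoplus_{a\in I_0}\mathbb Z_{\ge0}\overline\Lambda_a$. **Crystal.** The Kirillov–Reshetikhin crystal $B=B^{1,1}$ has vertices $1,\dots,27$ and the following arrows $b\xrightarrow{i}b'$ (meaning $f_ib=b'$, $e_ib'=b$; all other values of $e_i,f_i$ are $0$): $1\xrightarrow{1}2$, $2\xrightarrow{2}3$, $3\xrightarrow{3}4$, $4\xrightarrow{4}5$, $4\xrightarrow{6}7$, $5\xrightarrow{5}6$, $5\xrightarrow{6}8$, $6\xrightarrow{6}9$, $7\xrightarrow{4}8$, $8\xrightarrow{5}9$, $8\xrightarrow{3}10$, $9\xrightarrow{3}11$,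 $10\xrightarrow{5}11$, $10\xrightarrow{2}13$, $11\xrightarrow{4}12$, $11\xrightarrow{2}14$, $12\xrightarrow{2}15$, $13\xrightarrow{5}14$, $13\xrightarrow{1}18$, $14\xrightarrow{4}15$, $14\xrightarrow{1}19$, $15\xrightarrow{3}16$, $15\xrightarrow{1}20$, $16\xrightarrow{6}17$, $16\xrightarrow{1}21$, $17\xrightarrow{1}22$, $18\xrightarrow{5}19$, $19\xrightarrow{4}20$, $20\xrightarrow{3}21$, $21\xrightarrow{6}22$, $21\xrightarrow{2}23$, $22\xrightarrow{2}24$, $23\xrightarrow{6}24$, $24\xrightarrow{3}25$, $25\xrightarrow{4}26$, $26\xrightarrow{5}27$, and $17\xrightarrow{0}1$, $22\xrightarrow{0}2$, $24\xrightarrow{0}3$, $25\xrightarrow{0}4$, $26\xrightarrow{0}5$, $27\xrightarrow{0}6$. Put $\varepsilon_i(b)=\max\{k\mid e_i^kb\neq0\}$, $\varphi_i(b)=\max\{k\mid f_i^kb\ne0\}$ and $\mathrm{wt}(b)=\sum_{i\in I_0}(\varphi_i(b)-\varepsilon_i(b))\overline\Lambda_i$. On tensor products, $e_i(b_1\otimes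 b_2)$ is $e_ib_1\otimes b_2$ if $\varphi_i(b_1)\ge\varepsilon_i(b_2)$ and $b_1\otimes e_ib_2$ otherwise; $f_i(b_1\otimes b_2)$ is $f_ib_1\otimes b_2$ if $\varphi_i(b_1)>\varepsilon_i(b_2)$ and $b_1\otimes f_ib_2$ otherwise; weights add. For $\lambda\in\overline P^+$ and $L\ge0$ let $$\mathcal P(\lambda,L)=\{b\in B^{\otimes L}\mid \mathrm{wt}(b)=\lambda,\ e_ib=0\text{ for all }i\in I_0\}.$$ Let $H:B\otimes B\to\mathbb Z$ be the unique function with $H(1\otimes1)=0$ such that, whenever $e_i(b\otimes b')\neq0$, $H(e_i(b\otimes b'))-H(b\otimes b')$ equals $1$ if $i=0$ and $e_0(b\otimes b')=e_0b\otimes b'$, $-1$ if $i=0$ and $e_0(b\otimes b')=b\otimes e_0b'$, and $0$ if $i\ne0$. Put $$D(b_1\otimes\cdots\otimes b_L)=\sum_{j=1}^{L-1}(L-j)H(b_j\otimes b_{j+1}),\qquad X(\lambda,L;q)=\sum_{b\in\mathcal P(\lambda,L)}q^{D(b)}.$$ **Rigged configurations.** A configuration $\nu=(\nu^{(a)})_{a\in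 I_0}$ is a sequence of partitions; let $m_i^{(a)}$ be the number of parts of $\nu^{(a)}$ equal to $i$, and $$p_i^{(a)}=L\,\delta_{a1}-\sum_{b\in I_0}\sum_{j\ge1}C_{ab}\min(i,j)\,m_j^{(b)}\quad(i\ge1).$$ Let $C(\lambda,L)$ be the set of $\nu$ with $\sum_{a,i}i\,m_i^{(a)}\alpha_a=L\overline\Lambda_1-\lambda$ and $p_i^{(a)}\ge0$ for all $a\in I_0$, $i\ge1$. Let $\mathrm{RC}(\lambda,L)$ be the set of pairs $(\nu,J)$ with $\nu\in C(\lambda,L)$ and $J=(J^{(a,i)})$, where $J^{(a,i)}$ is a partition contained in an $m_i^{(a)}\times p_i^{(a)}$ rectangle; the parts of $J^{(a,i)}$, padded with zeros to $m_i^{(a)}$ entries, are the riggings of the rows of length $i$ of $\nu^{(a)}$. Put $$c(\nu)=\tfrac12\sum_{a,b\in I_0}\sum_{j,k\ge1}C_{ab}\min(j,k)m_j^{(a)}m_k^{(b)}-L\sum_{k\ge1}m_k^{(1)},\qquad c(\nu,J)=c(\nu)+\sum_{a,i}|J^{(a,i)}|,$$ $$M(\lambda,L;q)=\sum_{\nu\in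 C(\lambda,L)}q^{c(\nu)}\prod_{a\in I_0}\prod_{i\ge1}\begin{bmatrix}p_i^{(a)}+m_i^{(a)}\\ m_i^{(a)}\end{bmatrix}_q .$$ **The maps $\gamma$, $\delta$ and $\Phi$.** A row of length $i$ in $\nu^{(a)}$ is singular if its rigging is $p_i^{(a)}$. For $L\ge1$ and $(\nu,J)\in\mathrm{RC}(\lambda,L)$, start at the vertex $1$ with $\ell_0=1$. At step $j=1,2,\dots$, consider all arrows of colours $a\ne0$ starting at the current vertex and, for each, the minimal $i\ge\ell_{j-1}$ such that $\nu^{(a)}$ has a singular row of length $i$ not selected before ($\infty$ if there is none). If all these are $\infty$ (in particular, if there is no arrow), stop; otherwise take an arrow for which the value is smallest (in case of a tie, any of them), select such a row, let $\ell_j$ be its length, and move along the arrow. Let $\gamma(\nu,J)$ be the final vertex. Let $\delta(\nu,J)$ be obtained by removing one node from each selected row, giving each shortened row of positive length the rigging that makes it singular with respect to the vacancy numbers of the new configuration computed with $L-1$ in place of $L$, and keeping all other rows and their riggings. The map $\Phi$ is defined recursively: $\Phi$ of the empty rigged configuration is the empty path for $L=0$, and $\Phi(\nu,J)=\Phi(\delta(\nu,J))\otimes\gamma(\nu,J)$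 for $L\ge1$. **Theorem.** Let $\lambda\in\overline P^+$. 1. For $L\ge1$ and $(\nu,J)\in\mathrm{RC}(\lambda,L)$, the pair $(\gamma(\nu,J),\delta(\nu,J))$ does not depend on the choices made in case of ties, and $\lambda-\mathrm{wt}(\gamma(\nu,J))\in\overline P^+$. For every $b\in B$, $\delta$ restricts to a bijection from $\{(\nu,J)\in\mathrm{RC}(\lambda,L)\mid\gamma(\nu,J)=b\}$ to $\mathrm{RC}(\lambda-\mathrm{wt}(b),L-1)$ (the latter set, given by the same definition, is empty if $\lambda-\mathrm{wt}(b)\notin\overline P^+$). 2. For every $L\ge0$, $\Phi:\mathrm{RC}(\lambda,L)\to\mathcal P(\lambda,L)$ is a bijection, and $c(\nu,J)=D(\Phi(\nu,J))$ for all $(\nu,J)\in\mathrm{RC}(\lambda,L)$. 3. For every $L\ge0$, the set $C(\lambda,L)$ is finite and $X(\lambda,L;q)=M(\lambda,L;q)$. -/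

import Mathlib

/-!
# Paths, rigged configurations and the algorithm for the crystal `B^{1,1}` of type `E_6^{(1)}`

Dynkin nodes are labelled `0, ..., 6`: the chain is `1 - 2 - 3 - 4 - 5`, node `6` is attached to `3`
and the affine node `0` is attached to `6`.  The classical node with label `a + 1` is indexed by
`a : Fin 6` (so it is `a.succ : Fin 7`).
-/

namespace E6KKR

/-- Adjacency of nodes in the Dynkin diagram of `E_6^{(1)}`. -/
def Adjacent (i j : Fin 7) : Prop :=
  (i, j) ∈ ([(1, 2), (2, 3), (3, 4), (4, 5), (3, 6), (6, 0)] : List (Fin 7 × Fin 7)) ∨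
    (j, i) ∈ ([(1, 2), (2, 3), (3, 4), (4, 5), (3, 6), (6, 0)] : List (Fin 7 × Fin 7))

instance (i j : Fin 7) : Decidable (Adjacent i j) := by
  unfold Adjacent
  infer_instance

/-- The Cartan matrix of `E_6^{(1)}`. -/
def cartan (i j : Fin 7) : ℤ := if i = j then 2 else if Adjacent i j then -1 else 0

/-- The restriction of the Cartan matrix to the classical nodes; these are the values
`(α_a | α_b)` of the normalized form. -/
def cartan₀ (a b : Fin 6) : ℤ := cartan a.succ b.succ

/-- Classical weights, in coordinates with respect to the fundamental weights of `E_6`. -/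
abbrev Weight : Type := Fin 6 → ℤ

/-- Dominant classical weights. -/
def Dominant (lam : Weight) : Prop := ∀ a, 0 ≤ lam a

/-! ## Crystals -/

/-- The operators `e_i`, `f_i` of a crystal with vertex set `X`; `none` stands for `0`. -/
structure CrystalOps (X : Type) where
  e : Fin 7 → X → Option X
  f : Fin 7 → X → Option X

/-- Iterates of a partially defined operator. -/
def iter {X : Type} (g : X → Option X) : ℕ → X → Option X
  | 0, x => some x
  | k + 1, x => (g x).bind (iter g k)

/-- `ε_i(x) = max {k | e_i^k x ≠ 0}`. -/
noncomputable def CrystalOps.eps {X : Type} (C : CrystalOps X) (i : Fin 7) (x : X) : ℕ :=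
  sSup {k | iter (C.e i) k x ≠ none}

/-- `φ_i(x) = max {k | f_i^k x ≠ 0}`. -/
noncomputable def CrystalOps.phi {X : Type} (C : CrystalOps X) (i : Fin 7) (x : X) : ℕ :=
  sSup {k | iter (C.f i) k x ≠ none}

/-- The tensor product of crystals, in Kashiwara's original convention. -/
noncomputable def CrystalOps.tensor {X Y : Type} (C : CrystalOps X) (D : CrystalOps Y) :
    CrystalOps (X × Y) where
  e i t := if D.eps i t.2 ≤ C.phi i t.1 then (C.e i t.1).map (fun x => (x, t.2))
    else (D.e i t.2).map (fun y => (t.1, y))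
  f i t := if D.eps i t.2 < C.phi i t.1 then (C.f i t.1).map (fun x => (x, t.2))
    else (D.f i t.2).map (fun y => (t.1, y))

/-- The vertices of the crystal `B = B^{1,1}`, which carry the labels `1, ..., 27`.  Labels are
written as numerals of `Fin 27`, that is, modulo 27: the vertex with label `27` is `(27 : Fin 27)`,
which is the element `0`. -/
abbrev Box : Type := Fin 27

/-- The crystal graph of `B`: the triple `(b, i, b')` is the arrow of colour `i` from `b` to `b'`. -/
def arrows : List (Box × Fin 7 × Box) :=
  [
    (1, 1, 2), (2, 2, 3), (3, 3, 4), (4, 4, 5), (4, 6, 7), (5, 5, 6), (5, 6, 8), (6, 6, 9),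
    (7, 4, 8), (8, 5, 9), (8, 3, 10), (9, 3, 11), (10, 5, 11), (10, 2, 13), (11, 4, 12),
    (11, 2, 14), (12, 2, 15), (13, 5, 14), (13, 1, 18), (14, 4, 15), (14, 1, 19), (15, 3,
    16), (15, 1, 20), (16, 6, 17), (16, 1, 21), (17, 1, 22), (18, 5, 19), (19, 4, 20), (20,
    3, 21), (21, 6, 22), (21, 2, 23), (22, 2, 24), (23, 6, 24), (24, 3, 25), (25, 4, 26),
    (26, 5, 27), (17, 0, 1), (22, 0, 2), (24, 0, 3), (25, 0, 4), (26, 0, 5), (27, 0, 6)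
  ]

/-- The crystal `B = B^{1,1}`: `f_i b = b'`, equivalently `b = e_i b'`, when there is an arrow of
colour `i` from `b` to `b'`. -/
def boxCrystal : CrystalOps Box where
  e i b := (arrows.find? (fun t => t.2.2 = b ∧ t.2.1 = i)).map (fun t => t.1)
  f i b := (arrows.find? (fun t => t.1 = b ∧ t.2.1 = i)).map (fun t => t.2.2)

/-- The classical weight of a vertex of `B`. -/
noncomputable def boxWt (b : Box) : Weight :=
  fun a => (boxCrystal.phi a.succ b : ℤ) - boxCrystal.eps a.succ b

/-- Vertices `b_1 ⊗ ... ⊗ b_L` of `B^{⊗ L}`; the factor `b_{j+1}` is `p j`. -/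
abbrev Path (L : ℕ) : Type := Fin L → Box

/-- The crystal structure of `B^{⊗ L}`, with `B^{⊗ (L+1)} = B^{⊗ L} ⊗ B` and `B^{⊗ 0}` the trivial
crystal with one vertex. -/
noncomputable def pathCrystal : (L : ℕ) → CrystalOps (Path L)
  | 0 => { e := fun _ _ => none, f := fun _ _ => none }
  | L + 1 =>
    { e := fun i p => (((pathCrystal L).tensor boxCrystal).e i (Fin.init p, p (Fin.last L))).map
        (fun t => (Fin.snoc t.1 t.2 : Path (L + 1)))
      f := fun i p => (((pathCrystal L).tensor boxCrystal).f i (Fin.init p, p (Fin.last L))).map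
        (fun t => (Fin.snoc t.1 t.2 : Path (L + 1))) }

/-- The weight function on `B^{⊗ L}`. -/
noncomputable def pathWt {L : ℕ} (p : Path L) : Weight := ∑ j, boxWt (p j)

/-- The set `P(λ, L)` of classically restricted paths of weight `λ`. -/
def paths (lam : Weight) (L : ℕ) : Set (Path L) :=
  {p | pathWt p = lam ∧ ∀ a : Fin 6, (pathCrystal L).e a.succ p = none}

/-! ## The local energy function and the energy -/

/-- `H` is the normalized local energy function on `B ⊗ B`. -/
structure IsLocalEnergy (H : Box → Box → ℤ) : Prop where
  left : ∀ b b' c, (boxCrystal.tensor boxCrystal).e 0 (b, b') = some (c, b') →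
    H c b' = H b b' + 1
  right : ∀ b b' c', (boxCrystal.tensor boxCrystal).e 0 (b, b') = some (b, c') →
    H b c' = H b b' - 1
  classical : ∀ i : Fin 7, i ≠ 0 → ∀ b b' c c',
    (boxCrystal.tensor boxCrystal).e i (b, b') = some (c, c') → H c c' = H b b'
  norm : H 1 1 = 0

theorem box_e_e : ∀ (i : Fin 7) (b : Box), (boxCrystal.e i b).bind (boxCrystal.e i) = none := by
  decide +kernel

theorem box_f_f : ∀ (i : Fin 7) (b : Box), (boxCrystal.f i b).bind (boxCrystal.f i) = none := by
  decide +kernel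

theorem sSup_iter {X : Type} (g : X → Option X) (x : X) (h : (g x).bind g = none) :
    sSup {k | iter g k x ≠ none} = if (g x).isSome then 1 else 0 := by
  have h2 : ∀ k, iter g (k + 2) x = none := by
    intro k
    cases hx : g x with
    | none => simp [iter, hx]
    | some y =>
      rw [hx] at h
      have hy : g y = none := by simpa using h
      simp [iter, hx, hy]
  cases hx : g x with
  | none =>
    have : {k | iter g k x ≠ none} = {0} := by
      ext k
      rcases k with _ | k
      · simp [iter]
      · simp [iter, hx]
    simp [this]
  | some y =>
    have : {k | iter g k x ≠ none} = Set.Iic 1 := by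
      ext k
      rcases k with _ | _ | k
      · simp [iter]
      · simp [iter, hx]
      · simp [h2 k]
    rw [this]
    simp

theorem box_eps (i : Fin 7) (b : Box) :
    boxCrystal.eps i b = if (boxCrystal.e i b).isSome then 1 else 0 :=
  sSup_iter _ _ (box_e_e i b)

theorem box_phi (i : Fin 7) (b : Box) :
    boxCrystal.phi i b = if (boxCrystal.f i b).isSome then 1 else 0 :=
  sSup_iter _ _ (box_f_f i b)

/-- A computable form of `e_i` on `B ⊗ B`. -/
def pairE (i : Fin 7) (t : Box × Box) : Option (Box × Box) :=
  if (boxCrystal.e i t.2).isSome ≤ (boxCrystal.f i t.1).isSome then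
    (boxCrystal.e i t.1).map (fun x => (x, t.2))
  else (boxCrystal.e i t.2).map (fun y => (t.1, y))

theorem tensor_box_e (i : Fin 7) (t : Box × Box) :
    (boxCrystal.tensor boxCrystal).e i t = pairE i t := by
  unfold CrystalOps.tensor pairE
  simp only [box_eps, box_phi]
  rcases boxCrystal.e i t.2 with _ | _ <;> rcases boxCrystal.f i t.1 with _ | _ <;> simp

theorem e_mem {i : Fin 7} {b s : Box} (h : boxCrystal.e i b = some s) : (s, i, b) ∈ arrows := by
  simp only [boxCrystal, Option.map_eq_some_iff] at h
  obtain ⟨⟨s', i', b'⟩, h, rfl⟩ := h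
  have h1 := List.find?_some h
  have h2 := List.mem_of_find?_eq_some h
  simp only [decide_eq_true_eq] at h1
  obtain ⟨rfl, rfl⟩ := h1
  exact h2

theorem arrow_label : ∀ t ∈ arrows, t.2.1 ≠ 0 → (t.1 - 1 : Box).val < (t.2.2 - 1 : Box).val := by
  have key : (arrows.all fun t => decide (t.2.1 ≠ 0 → (t.1 - 1 : Box).val < (t.2.2 - 1 : Box).val)) = true := by
    decide +kernel
  intro t ht
  exact of_decide_eq_true (List.all_eq_true.1 key t ht)

theorem arrow_end : ∀ t ∈ arrows, boxCrystal.f t.2.1 t.2.2 = none := by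
  have key : (arrows.all fun t => decide (boxCrystal.f t.2.1 t.2.2 = none)) = true := by
    decide +kernel
  intro t ht
  exact of_decide_eq_true (List.all_eq_true.1 key t ht)

theorem pairE_some {i : Fin 7} {t u : Box × Box} (h : pairE i t = some u) :
    (u.2 = t.2 ∧ (u.1, i, t.1) ∈ arrows ∧ boxCrystal.e i t.2 = none) ∨
      (u.1 = t.1 ∧ (u.2, i, t.2) ∈ arrows ∧ boxCrystal.f i t.1 = none) := by
  unfold pairE at h
  split_ifs at h with hc
  · left
    rw [Option.map_eq_some_iff] at h
    obtain ⟨s, hs, rfl⟩ := h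
    have hm := e_mem hs
    refine ⟨rfl, hm, ?_⟩
    have := arrow_end _ hm
    simp only at this
    rw [this] at hc
    rcases he : boxCrystal.e i t.2 with _ | v
    · rfl
    · rw [he] at hc
      exact absurd hc (show ¬ (true ≤ false) by decide)
  · right
    rw [Option.map_eq_some_iff] at h
    obtain ⟨s, hs, rfl⟩ := h
    refine ⟨rfl, e_mem hs, ?_⟩
    rcases hf : boxCrystal.f i t.1 with _ | v
    · rfl
    · simp [hf] at hc

/-- Minus the values of the local energy function, as the ternary digits of one number. -/
def energyCode : ℕ :=
  115893625687117560996641570969819257155809656434492426037851075848809011653959388640782469287778420013909565856422773173599971196887422618772579202290167077975975853727719546509339366662530931382709601217778713809104578042589762161222586294085866846159857699643584840604582347899618861976714591256302194606314584191745108815597249535733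

/-- Minus the value of the local energy function (used only to show that it exists). -/
def energyDigit (b b' : Box) : ℕ :=
  Nat.mod (Nat.div energyCode (Nat.pow 3 (Nat.add (Nat.mul 27 b.val) b'.val))) 3

theorem energyDigit_right : ∀ t ∈ arrows, ∀ b : Box, boxCrystal.f t.2.1 b = none →
    energyDigit b t.1 = energyDigit b t.2.2 + if t.2.1 = 0 then 1 else 0 := by
  have key : (arrows.all fun t => (List.finRange 27).all fun b =>
      (boxCrystal.f t.2.1 b).isSome ||
        Nat.beq (energyDigit b t.1) (energyDigit b t.2.2 + if t.2.1 = 0 then 1 else 0)) = true := by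
    decide +kernel
  intro t ht b hb
  have h := List.all_eq_true.1 (List.all_eq_true.1 key t ht) b (List.mem_finRange b)
  rw [hb] at h
  exact Nat.eq_of_beq_eq_true (by simpa using h)

theorem energyDigit_left : ∀ t ∈ arrows, ∀ b : Box, boxCrystal.e t.2.1 b = none →
    energyDigit t.2.2 b = energyDigit t.1 b + if t.2.1 = 0 then 1 else 0 := by
  have key : (arrows.all fun t => (List.finRange 27).all fun b =>
      (boxCrystal.e t.2.1 b).isSome ||
        Nat.beq (energyDigit t.2.2 b) (energyDigit t.1 b + if t.2.1 = 0 then 1 else 0)) = true := by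
    decide +kernel
  intro t ht b hb
  have h := List.all_eq_true.1 (List.all_eq_true.1 key t ht) b (List.mem_finRange b)
  rw [hb] at h
  exact Nat.eq_of_beq_eq_true (by simpa using h)

theorem arrow_ne : ∀ t ∈ arrows, t.1 ≠ t.2.2 := by
  have key : (arrows.all fun t => decide (t.1 ≠ t.2.2)) = true := by
    decide +kernel
  intro t ht
  exact of_decide_eq_true (List.all_eq_true.1 key t ht)

theorem isLocalEnergy_energyDigit : IsLocalEnergy (fun b b' => -(energyDigit b b' : ℤ)) where
  left b b' c h := by
    rw [tensor_box_e] at h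
    rcases pairE_some h with ⟨_, h1, h2⟩ | ⟨_, h1, _⟩
    · have := energyDigit_left _ h1 b' h2
      simp only [if_true] at this
      simp only [this]
      push_cast
      ring
    · exact absurd rfl (arrow_ne _ h1)
  right b b' c h := by
    rw [tensor_box_e] at h
    rcases pairE_some h with ⟨_, h1, _⟩ | ⟨_, h1, h2⟩
    · exact absurd rfl (arrow_ne _ h1)
    · have := energyDigit_right _ h1 b h2
      simp only [if_true] at this
      simp only [this]
      push_cast
      ring
  classical i hi b b' c c' h := by
    rw [tensor_box_e] at h
    rcases pairE_some h with ⟨h0, h1, h2⟩ | ⟨h0, h1, h2⟩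
    · have := energyDigit_left _ h1 b' h2
      simp only [hi, if_false, add_zero] at this
      simp only at h0
      rw [h0, this]
    · have := energyDigit_right _ h1 b h2
      simp only [hi, if_false, add_zero] at this
      simp only at h0
      rw [h0, this]
  norm := by decide +kernel

theorem raise_box : ∀ b : Box, b ≠ 1 → ∃ i : Fin 7, i ≠ 0 ∧ (boxCrystal.e i b).isSome := by
  decide +kernel

theorem raise_box_one : ∀ c : Box, c ≠ 1 → c ≠ 2 → c ≠ 18 →
    ∃ i : Fin 7, i ≠ 0 ∧ (boxCrystal.e i c).isSome ∧ boxCrystal.f i 1 = none := by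
  decide +kernel

theorem pair_raise (t : Box × Box) : t = (1, 1) ∨ t = (1, 2) ∨ t = (1, 18) ∨
    ∃ i : Fin 7, i ≠ 0 ∧ ∃ u, pairE i t = some u := by
  obtain ⟨b, c⟩ := t
  by_cases hb : b = 1
  · subst hb
    by_cases h1 : c = 1
    · simp [h1]
    by_cases h2 : c = 2
    · simp [h2]
    by_cases h3 : c = 18
    · simp [h3]
    obtain ⟨i, hi, he, hf⟩ := raise_box_one c h1 h2 h3
    obtain ⟨v, hv⟩ := Option.isSome_iff_exists.1 he
    exact Or.inr (Or.inr (Or.inr ⟨i, hi, (1, v), by simp [pairE, hv, hf]⟩))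
  · obtain ⟨i, hi, he⟩ := raise_box b hb
    obtain ⟨v, hv⟩ := Option.isSome_iff_exists.1 he
    refine Or.inr (Or.inr (Or.inr ⟨i, hi, ?_⟩))
    unfold pairE
    split_ifs with hc
    · exact ⟨(v, c), by simp [hv]⟩
    · rcases hx : boxCrystal.e i c with _ | w
      · simp [hx] at hc
      · exact ⟨(b, w), by simp⟩

theorem pair_label {i : Fin 7} (hi : i ≠ 0) {t u : Box × Box} (h : pairE i t = some u) :
    (u.1 - 1 : Box).val + (u.2 - 1 : Box).val < (t.1 - 1 : Box).val + (t.2 - 1 : Box).val := by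
  rcases pairE_some h with ⟨h0, h1, _⟩ | ⟨h0, h1, _⟩
  · have := arrow_label _ h1 hi
    rw [h0]
    simp only at this
    omega
  · have := arrow_label _ h1 hi
    rw [h0]
    simp only at this
    omega

theorem IsLocalEnergy.unique {H K : Box → Box → ℤ} (h : IsLocalEnergy H) (k : IsLocalEnergy K) :
    H = K := by
  have cl : ∀ {H : Box → Box → ℤ}, IsLocalEnergy H → ∀ i : Fin 7, i ≠ 0 → ∀ t u,
      pairE i t = some u → H u.1 u.2 = H t.1 t.2 := by
    intro H h i hi t u htu
    exact h.classical i hi t.1 t.2 u.1 u.2 (by rw [tensor_box_e]; exact htu)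
  have climb : ∀ (P : Box × Box → Prop), P (1, 1) → P (1, 2) → P (1, 18) →
      (∀ i : Fin 7, i ≠ 0 → ∀ t u, pairE i t = some u → P u → P t) → ∀ t, P t := by
    intro P h1 h2 h3 hs t
    induction hn : (t.1 - 1 : Box).val + (t.2 - 1 : Box).val using
      Nat.strong_induction_on generalizing t with
    | _ n ih =>
      rcases pair_raise t with rfl | rfl | rfl | ⟨i, hi, u, hu⟩
      · exact h1
      · exact h2
      · exact h3
      · exact hs i hi t u hu (ih _ (hn ▸ pair_label hi hu) u rfl)
  have val : ∀ {H : Box → Box → ℤ}, IsLocalEnergy H → H 1 2 = -1 ∧ H 1 18 = -2 := by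
    intro H h
    have h11 : H 1 1 = 0 := h.norm
    have e0 := h.right 1 1 17 (by rw [tensor_box_e]; decide +kernel)
    have e1 := cl h 6 (by decide) (1, 17) (1, 16) (by decide +kernel)
    have e2 := cl h 3 (by decide) (1, 16) (1, 15) (by decide +kernel)
    have e3 := cl h 4 (by decide) (1, 15) (1, 14) (by decide +kernel)
    have e4 := cl h 5 (by decide) (1, 14) (1, 13) (by decide +kernel)
    have e5 := cl h 2 (by decide) (1, 13) (1, 10) (by decide +kernel)
    have e6 := cl h 3 (by decide) (1, 10) (1, 8) (by decide +kernel)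
    have e7 := cl h 4 (by decide) (1, 8) (1, 7) (by decide +kernel)
    have e8 := cl h 6 (by decide) (1, 7) (1, 4) (by decide +kernel)
    have e9 := cl h 3 (by decide) (1, 4) (1, 3) (by decide +kernel)
    have e10 := cl h 2 (by decide) (1, 3) (1, 2) (by decide +kernel)
    have d0 := h.right 1 2 22 (by rw [tensor_box_e]; decide +kernel)
    have d1 := cl h 6 (by decide) (1, 22) (1, 21) (by decide +kernel)
    have d2 := cl h 3 (by decide) (1, 21) (1, 20) (by decide +kernel)
    have d3 := cl h 4 (by decide) (1, 20) (1, 19) (by decide +kernel)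
    have d4 := cl h 5 (by decide) (1, 19) (1, 18) (by decide +kernel)
    simp only at e1 e2 e3 e4 e5 e6 e7 e8 e9 e10 d1 d2 d3 d4
    constructor
    · linarith
    · linarith
  have main := climb (fun t => H t.1 t.2 = K t.1 t.2)
    (by simp only [h.norm, k.norm]) (by simp only [(val h).1, (val k).1])
    (by simp only [(val h).2, (val k).2])
    (fun i hi t u htu hu => by rw [← cl h i hi t u htu, ← cl k i hi t u htu]; exact hu)
  funext b b'
  exact main (b, b')

/-- The normalized local energy function exists and is unique. -/
theorem existsUnique_localEnergy : ∃! H : Box → Box → ℤ, IsLocalEnergy H :=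
  ⟨_, isLocalEnergy_energyDigit, fun _ h => h.unique isLocalEnergy_energyDigit⟩

/-- The normalized local energy function `H : B ⊗ B → ℤ`. -/
noncomputable def localEnergy : Box → Box → ℤ := existsUnique_localEnergy.choose

theorem isLocalEnergy_localEnergy : IsLocalEnergy localEnergy :=
  existsUnique_localEnergy.choose_spec.1

/-- The energy `D(b_1 ⊗ ... ⊗ b_L) = ∑_{j=1}^{L-1} (L - j) H(b_j ⊗ b_{j+1})`. -/
noncomputable def energy : {L : ℕ} → Path L → ℤ
  | 0, _ => 0
  | n + 1, p => ∑ j : Fin n, ((n : ℤ) - (j : ℤ)) * localEnergy (p j.castSucc) (p j.succ)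

/-- The one-dimensional sum `X(λ, L; q)`; here `q` is `LaurentPolynomial.T 1`. -/
noncomputable def oneDimSum (lam : Weight) (L : ℕ) : LaurentPolynomial ℤ :=
  ∑ᶠ p ∈ paths lam L, LaurentPolynomial.T (energy p)

/-! ## Configurations and the fermionic formula -/

/-- A sequence `ν = (ν^{(a)})` of partitions, each given as the multiset of its parts, so that
`m_i^{(a)} = (ν a).count i`.  (Positivity of the parts is part of admissibility.) -/
abbrev Config : Type := Fin 6 → Multiset ℕ

/-- `Q_i(μ)`, the area of the first `i` columns of `μ`. -/
def area (i : ℕ) (μ : Multiset ℕ) : ℤ := (μ.map (fun k => ((min i k : ℕ) : ℤ))).sum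

/-- The vacancy number `p_i^{(a)}` for `L_i^{(a)} = L δ_{a1} δ_{i1}`; for `i = 0` it is `0`. -/
def vacancy (L : ℕ) (ν : Config) (a : Fin 6) (i : ℕ) : ℤ :=
  (if a = 0 then (L : ℤ) * ((min i 1 : ℕ) : ℤ) else 0) - ∑ b, cartan₀ a b * area i (ν b)

/-- The set `C(λ, L)` of admissible configurations.  The weight condition
`∑ i m_i^{(a)} α_a = L Λ_1 - λ` is read off in the basis of fundamental weights, where
`α_a = ∑_b C_{ab} Λ_b`. -/
def configs (lam : Weight) (L : ℕ) : Set Config :=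
  {ν | (∀ a, ∀ k ∈ ν a, 0 < k) ∧
    (∀ b, ∑ a, ((ν a).sum : ℤ) * cartan₀ a b = (if b = 0 then (L : ℤ) else 0) - lam b) ∧
    ∀ a i, 0 < i → 0 ≤ vacancy L ν a i}

/-- `∑_{j,k} min(j,k) m_j m'_k` for two partitions. -/
def minPair (μ μ' : Multiset ℕ) : ℤ := (μ.map (fun j => area j μ')).sum

/-- The charge `c(ν)`; the division by two is exact, see `two_mul_half`. -/
def charge (L : ℕ) (ν : Config) : ℤ :=
  (∑ a, ∑ b, cartan₀ a b * minPair (ν a) (ν b)) / 2 -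
    (L : ℤ) * ((ν 0).map (fun k => ((min 1 k : ℕ) : ℤ))).sum

theorem minPair_comm (μ μ' : Multiset ℕ) : minPair μ μ' = minPair μ' μ := by
  unfold minPair area
  rw [Multiset.sum_map_sum_map]
  simp only [min_comm]

theorem two_mul_half (ν : Config) :
    2 * ((∑ a, ∑ b, cartan₀ a b * minPair (ν a) (ν b)) / 2) =
      ∑ a, ∑ b, cartan₀ a b * minPair (ν a) (ν b) := by
  have hc : ∀ a b : Fin 6, cartan₀ a b = (if a = b then 2 else
      if (a, b) ∈ ([(0, 1), (1, 2), (2, 3), (3, 4), (2, 5), (1, 0), (2, 1), (3, 2), (4, 3), (5, 2)] :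
        List (Fin 6 × Fin 6)) then -1 else 0) := by
    decide +kernel
  apply Int.mul_ediv_cancel'
  have h01 := minPair_comm (ν 0) (ν 1)
  have h12 := minPair_comm (ν 1) (ν 2)
  have h23 := minPair_comm (ν 2) (ν 3)
  have h34 := minPair_comm (ν 3) (ν 4)
  have h25 := minPair_comm (ν 2) (ν 5)
  simp [Fin.sum_univ_six, hc]
  omega

/-- The Gaussian binomial coefficient, through the `q`-Pascal recursion. -/
noncomputable def qBinom : ℕ → ℕ → LaurentPolynomial ℤ
  | _, 0 => 1
  | 0, _ + 1 => 0
  | n + 1, k + 1 => qBinom n k + LaurentPolynomial.T ((k : ℤ) + 1) * qBinom n (k + 1)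

/-- The fermionic formula `M(λ, L; q)`.  The factors with `m_i^{(a)} = 0` are equal to `1`, so the
product is taken over the part sizes that occur. -/
noncomputable def fermionic (lam : Weight) (L : ℕ) : LaurentPolynomial ℤ :=
  ∑ᶠ ν ∈ configs lam L, LaurentPolynomial.T (charge L ν) *
    ∏ a, ∏ i ∈ (ν a).toFinset,
      qBinom ((vacancy L ν a i).toNat + (ν a).count i) ((ν a).count i)

/-! ## Rigged configurations -/

/-- A pair `(ν, J)`: for every `a`, the multiset of the rows of `ν^{(a)}`, a row of length `i` with
rigging `r` being the pair `(i, r)`.  The riggings of the rows of length `i` are the parts of the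
partition `J^{(a,i)}`, padded with zeros to `m_i^{(a)}` entries. -/
abbrev Rigged : Type := Fin 6 → Multiset (ℕ × ℤ)

/-- The underlying configuration `ν` of `(ν, J)`. -/
def shape (x : Rigged) : Config := fun a => (x a).map Prod.fst

/-- The set `RC(λ, L)`: `ν` is admissible and `J^{(a,i)}` is contained in an
`m_i^{(a)} × p_i^{(a)}` rectangle. -/
def riggedConfigs (lam : Weight) (L : ℕ) : Set Rigged :=
  {x | shape x ∈ configs lam L ∧ ∀ a, ∀ s ∈ x a, 0 ≤ s.2 ∧ s.2 ≤ vacancy L (shape x) a s.1}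

/-- The statistic `c(ν, J) = c(ν) + |J|`. -/
def riggedCharge (L : ℕ) (x : Rigged) : ℤ :=
  charge L (shape x) + ∑ a, ((x a).map Prod.snd).sum

/-! ## The algorithm -/

/-- From the vertex `b`, with current length `l` and with rows of lengths `S a` already used in
`ν^{(a)}`: there is an arrow of colour `a` starting at `b`, and `ν^{(a)}` has an unused singular row
of length `i ≥ l`. -/
def Candidate (L : ℕ) (x : Rigged) (b : Box) (l : ℕ) (S : Config) (a : Fin 6) (i : ℕ) : Prop :=
  boxCrystal.f a.succ b ≠ none ∧ l ≤ i ∧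
    (S a).count i < (x a).count (i, vacancy L (shape x) a i)

/-- `Route L x b l S`: the algorithm applied to `x`, started at the vertex `1` with length `1`, can
reach the vertex `b` with last selected length `l`, after selecting in each `ν^{(a)}` singular rows
of lengths `S a`.  At each step a candidate of minimal length is taken; if two arrows have candidates
of the same minimal length, either one may be taken. -/
inductive Route (L : ℕ) (x : Rigged) : Box → ℕ → Config → Prop
  | start : Route L x 1 1 (fun _ => 0)
  | step (b b' : Box) (l : ℕ) (S : Config) (a : Fin 6) (i : ℕ) :
      Route L x b l S → boxCrystal.f a.succ b = some b' → Candidate L x b l S a i →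
      (∀ a' i', Candidate L x b l S a' i' → i ≤ i') →
      Route L x b' i (Function.update S a (i ::ₘ S a))

/-- The new shape after the removal of one node from rows of lengths `S a` of `ν^{(a)}`; rows of
length zero are dropped. -/
def newShape (ν S : Config) : Config :=
  fun a => (ν a - S a) + ((S a).filter (fun i => 1 < i)).map (fun i => i - 1)

/-- The new rigged configuration: one node is removed from each selected singular row, the shortened
rows are made singular for the new vacancy numbers (those of the new shape, with `L` instead of
`L + 1`), and all other rows keep their riggings. -/
def newRigged (L : ℕ) (x : Rigged) (S : Config) : Rigged :=
  fun a => (x a - (S a).map (fun i => (i, vacancy (L + 1) (shape x) a i))) +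
    ((S a).filter (fun i => 1 < i)).map
      (fun i => (i - 1, vacancy L (newShape (shape x) S) a (i - 1)))

/-- The algorithm, applied to `x` (for `B^{⊗ (L+1)}`), can stop at the vertex `b` and yield `y`. -/
def Outcome (L : ℕ) (x : Rigged) (b : Box) (y : Rigged) : Prop :=
  ∃ l S, Route (L + 1) x b l S ∧ (∀ a i, ¬ Candidate (L + 1) x b l S a i) ∧ y = newRigged L x S

/-- The vertex `γ(ν, J)` and the rigged configuration `δ(ν, J)`, for `(ν, J)` in `RC(λ, L + 1)`. -/
noncomputable def gammaDelta (L : ℕ) (x : Rigged) : Box × Rigged :=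
  Classical.epsilon (fun r => Outcome L x r.1 r.2)

/-- The map `Φ`, with `Φ(ν, J) = Φ(δ(ν, J)) ⊗ γ(ν, J)`. -/
noncomputable def Phi : (L : ℕ) → Rigged → Path L
  | 0, _ => Fin.elim0
  | L + 1, x => Fin.snoc (Phi L (gammaDelta L x).2) (gammaDelta L x).1

end E6KKR

/-!
# The bijection between rigged configurations and paths for `B^{1,1}` of type `E_6^{(1)}`

The crystal `B` is minuscule: every coroot takes the values `-1, 0, 1` on the weights `wt b`
(`pairing_mem`), a vertex is determined by its content, that is, by the number of arrows of each
colour on a path from the vertex `1`, and moves down the crystal are increases of the content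
(`content_le_or_exists_f`).  A run of the algorithm is therefore encoded by the sequence of the
vertices `v i` reached after the selection of all rows of length at most `i` (`Tower`).  The greedy
rule becomes a condition for each length separately (`Forward`): from `v (i - 1)` one moves down as
far as the singular rows of length `i` allow.  The vertex `v i` is unique with this property, which
is why ties do not matter (`outcome_iff`).

*Bijectivity of `δ`.*  Removing the nodes changes the vacancy numbers for length `i` by
`p'_i = p_i - ⟨h_a, wt (v i)⟩` (`Tower.vacancy_eq`).  Hence `x` and `δ x` have a symmetric
description (`Link`): both consist of a common part `U`, whose riggings lie between `0` and
`min (p_i, p'_i)`, and of singular rows prescribed by `v`.  The bound by `p'_i` is the greedy rule of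
the algorithm, and the bound by `p_i` that of the inverse algorithm, which climbs from `b` to `1`
(`Backward`).  The new vacancy numbers stay nonnegative because `p_i` is convex up to the
contributions of the rows: a negative value at `i` would propagate downwards to length zero
(`Forward.vacancy_pos`), and for the inverse algorithm upwards to infinity, where it would contradict
the dominance of `λ` (`Backward.vacancy_pos`).

*Paths.*  For dominant `λ` and any `b`, the path `p ⊗ b` is classically restricted of weight `λ` if
and only if `p` is so of weight `λ - wt b` (`mem_paths_succ`), so that `Φ` is a bijection by induction.

*The statistics.*  The charge of `δ x` exceeds that of `x` by the number of rows of `ν^{(1)}` in `x`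
(`Link.riggedCharge_eq`); the quadratic terms telescope along the tower because all the weights `wt b`
have the same length.  It remains to see that `-H(γ(δ x) ⊗ γ(x))` is the number of rows that
disappear from `ν^{(1)}`, which is `content (v 1) 0`.  Now `-H(c' ⊗ c)` is the least number of
`0`-arrows on a path from `c` to `c'`, and the condition `-H(c' ⊗ c) ≤ n` is an inequality between
contents, shifted by `n` times the null root (`energyDigit_le_iff`).  If `v` and `v'` are the towers of
`x` and `δ x`, these inequalities for the pair `v' i`, `v (i + 1)` do not depend on `i`
(`energyDigit_tower`); for `i = 0` they give `content (v 1) 0`, and for large `i` the local energy of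
the two final vertices.

*The fermionic formula.*  The riggings of the rows of one length form a partition in a rectangle, with
generating function a Gaussian binomial coefficient (`hasGenFun_rectangle`), so that `M(λ, L; q)` is
the generating function of the charge on `RC(λ, L)`.
-/

namespace E6KKR

/-! ### Contents and weights of the vertices -/

/-- The rows of `content`, indexed by the vertices `27, 1, 2, ..., 26` in this order. -/
def contentTable : List (List ℕ) :=
  [[2, 3, 4, 3, 2, 2], [0, 0, 0, 0, 0, 0], [1, 0, 0, 0, 0, 0], [1, 1, 0, 0, 0, 0],
   [1, 1, 1, 0, 0, 0], [1, 1, 1, 1, 0, 0], [1, 1, 1, 1, 1, 0], [1, 1, 1, 0, 0, 1],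
   [1, 1, 1, 1, 0, 1], [1, 1, 1, 1, 1, 1], [1, 1, 2, 1, 0, 1], [1, 1, 2, 1, 1, 1],
   [1, 1, 2, 2, 1, 1], [1, 2, 2, 1, 0, 1], [1, 2, 2, 1, 1, 1], [1, 2, 2, 2, 1, 1],
   [1, 2, 3, 2, 1, 1], [1, 2, 3, 2, 1, 2], [2, 2, 2, 1, 0, 1], [2, 2, 2, 1, 1, 1],
   [2, 2, 2, 2, 1, 1], [2, 2, 3, 2, 1, 1], [2, 2, 3, 2, 1, 2], [2, 3, 3, 2, 1, 1],
   [2, 3, 3, 2, 1, 2], [2, 3, 4, 2, 1, 2], [2, 3, 4, 3, 1, 2]]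

/-- The number of arrows of colour `a.succ` on any path of classical arrows from the vertex `1`
to `b`; thus `wt b = Λ_1 - ∑ a, content b a • α_a`. -/
def content (b : Box) (a : Fin 6) : ℕ := (contentTable.getD b.val []).getD a.val 0

/-- The value of the coroot `h_a` on the weight of `b`, computed from the content of `b`. -/
def pairing (b : Box) (a : Fin 6) : ℤ :=
  (if a = 0 then 1 else 0) - ∑ c, cartan₀ a c * content b c

/-- The coefficients of the classical simple roots in the null root of `E_6^{(1)}`; the coefficient
of `α_0` is one. -/
def nullRoot (a : Fin 6) : ℕ := [1, 2, 3, 2, 1, 2].getD a.val 0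

theorem cartan₀_eq : ∀ a b : Fin 6, cartan₀ a b = (if a = b then 2 else
    if (a, b) ∈ ([(0, 1), (1, 2), (2, 3), (3, 4), (2, 5), (1, 0), (2, 1), (3, 2), (4, 3), (5, 2)] :
      List (Fin 6 × Fin 6)) then -1 else 0) := by
  decide +kernel

theorem cartan₀_comm : ∀ a b : Fin 6, cartan₀ a b = cartan₀ b a := by
  decide +kernel

theorem cartan₀_nonpos : ∀ a b : Fin 6, a ≠ b → cartan₀ a b ≤ 0 := by
  decide +kernel

theorem content_one : ∀ a, content 1 a = 0 := by
  decide +kernel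

theorem content_f : ∀ (b : Box) (a : Fin 6) (b' : Box), boxCrystal.f a.succ b = some b' →
    ∀ c, content b' c = content b c + if c = a then 1 else 0 := by
  decide +kernel

theorem content_e : ∀ (b : Box) (a : Fin 6) (b' : Box), boxCrystal.e a.succ b = some b' →
    ∀ c, content b c = content b' c + if c = a then 1 else 0 := by
  decide +kernel

theorem f_ne_none_iff : ∀ (b : Box) (a : Fin 6),
    boxCrystal.f a.succ b ≠ none ↔ pairing b a = 1 := by
  decide +kernel

theorem e_ne_none_iff : ∀ (b : Box) (a : Fin 6),
    boxCrystal.e a.succ b ≠ none ↔ pairing b a = -1 := by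
  decide +kernel

/-- The representation with weights `wt b` is minuscule. -/
theorem pairing_mem : ∀ (b : Box) (a : Fin 6), -1 ≤ pairing b a ∧ pairing b a ≤ 1 := by
  decide +kernel

theorem boxWt_eq_pairing (b : Box) : boxWt b = pairing b := by
  have key : ∀ (b : Box) (a : Fin 6),
      (((if (boxCrystal.f a.succ b).isSome then 1 else 0 : ℕ) : ℤ) -
        ((if (boxCrystal.e a.succ b).isSome then 1 else 0 : ℕ) : ℤ)) = pairing b a := by
    decide +kernel
  funext a
  rw [boxWt, box_phi, box_eps, key]

/-- All the weights `wt b` have the same length as `Λ_1`. -/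
theorem content_norm : ∀ b : Box,
    ∑ a, ∑ c, cartan₀ a c * ((content b a : ℤ) * content b c) = 2 * content b 0 := by
  decide +kernel

theorem pairing_one : ∀ a, pairing 1 a = if a = 0 then 1 else 0 := by
  decide +kernel

theorem content_injective {b b' : Box} (h : ∀ a, content b a = content b' a) : b = b' := by
  have key : ∀ b b' : Box, (∀ a, content b a = content b' a) → b = b' := by
    decide +kernel
  exact key b b' h

theorem eq_one_of_pairing_nonneg : ∀ b : Box, (∀ a, 0 ≤ pairing b a) → b = 1 := by
  decide +kernel

/-- The vertices of the affinization `B × ℤ` correspond to the order ideals of a heap, whose elements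
are coloured by the nodes.  If the ideal of `c'`, shifted by `n`, does not contain that of `c`, then a
minimal element of the difference can be added to the former: there is an arrow starting at `c'`
whose colour is one in which the ideal of `c'` is too small. -/
theorem exists_f_of_not_le : ∀ n : Fin 2, ∀ c c' : Box,
    (∀ a, content c a ≤ content c' a + n.val * nullRoot a) ∨
      ∃ a : Fin 6, boxCrystal.f a.succ c' ≠ none ∧
        content c' a + n.val * nullRoot a < content c a := by
  decide +kernel

/-- The dual of `exists_f_of_not_le`: a maximal element of the difference of the two ideals can be
removed from the ideal of `c`. -/
theorem exists_e_of_not_le : ∀ n : Fin 2, ∀ c c' : Box,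
    (∀ a, content c a ≤ content c' a + n.val * nullRoot a) ∨
      ∃ a : Fin 6, boxCrystal.e a.succ c ≠ none ∧
        content c' a + n.val * nullRoot a < content c a := by
  decide +kernel

theorem content_le_or_exists_f (c c' : Box) : (∀ a, content c a ≤ content c' a) ∨
    ∃ a : Fin 6, boxCrystal.f a.succ c' ≠ none ∧ content c' a < content c a := by
  simpa using exists_f_of_not_le 0 c c'

theorem content_le_or_exists_e (c c' : Box) : (∀ a, content c a ≤ content c' a) ∨
    ∃ a : Fin 6, boxCrystal.e a.succ c ≠ none ∧ content c' a < content c a := by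
  simpa using exists_e_of_not_le 0 c c'

theorem f_ne_none_of_content_le : ∀ (b c : Box) (a : Fin 6),
    (∀ a, content b a ≤ content c a) → content b a = content c a →
      boxCrystal.f a.succ b ≠ none → boxCrystal.f a.succ c ≠ none := by
  decide +kernel

/-- Minus the local energy of `c' ⊗ c` is the least `n` such that the ideal of `c` is contained in the
ideal of `c'` shifted by `n`; equivalently, it is the least number of arrows of colour `0` on a path
from `c` to `c'`. -/
theorem energyDigit_le_iff : ∀ n : Fin 2, ∀ c c' : Box,
    energyDigit c' c ≤ n.val ↔ ∀ a, content c a ≤ content c' a + n.val * nullRoot a := by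
  decide +kernel

theorem energyDigit_one : ∀ c : Box, energyDigit 1 c = content c 0 := by
  decide +kernel

theorem energyDigit_le_two (b b' : Box) : energyDigit b b' ≤ 2 :=
  Nat.lt_succ_iff.1 (Nat.mod_lt _ (by norm_num))

theorem localEnergy_eq (b b' : Box) : localEnergy b b' = -(energyDigit b b' : ℤ) := by
  rw [isLocalEnergy_localEnergy.unique isLocalEnergy_energyDigit]

theorem energyDigit_eq_of_forall {b b' c c' : Box}
    (h : ∀ n : Fin 2, (∀ a, content b a ≤ content b' a + n.val * nullRoot a) ↔
      ∀ a, content c a ≤ content c' a + n.val * nullRoot a) :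
    energyDigit b' b = energyDigit c' c := by
  have h0 : energyDigit b' b ≤ 0 ↔ energyDigit c' c ≤ 0 := by
    have := h 0
    rwa [← energyDigit_le_iff, ← energyDigit_le_iff] at this
  have h1 : energyDigit b' b ≤ 1 ↔ energyDigit c' c ≤ 1 := by
    have := h 1
    rwa [← energyDigit_le_iff, ← energyDigit_le_iff] at this
  have := energyDigit_le_two b' b
  have := energyDigit_le_two c' c
  omega

theorem sum_content_f {b b' : Box} {a : Fin 6} (h : boxCrystal.f a.succ b = some b') :
    ∑ c, content b' c = ∑ c, content b c + 1 := by
  simp [content_f b a b' h, Finset.sum_add_distrib]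

theorem sum_content_e {b b' : Box} {a : Fin 6} (h : boxCrystal.e a.succ b = some b') :
    ∑ c, content b c = ∑ c, content b' c + 1 := by
  simp [content_e b a b' h, Finset.sum_add_distrib]

/-- Greedy moves down from `c`, with `t a` arrows of colour `a` allowed, end at a vertex from which
no allowed arrow starts. -/
theorem exists_greedy_down (c : Box) (t : Fin 6 → ℕ) : ∃ c' : Box,
    (∀ a, content c a ≤ content c' a) ∧ (∀ a, content c' a ≤ content c a + t a) ∧
      ∀ a, boxCrystal.f a.succ c' ≠ none → content c' a = content c a + t a := by
  classical
  let s : Finset Box := Finset.univ.filter fun c' =>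
    (∀ a, content c a ≤ content c' a) ∧ ∀ a, content c' a ≤ content c a + t a
  have hs : s.Nonempty := ⟨c, by simp [s]⟩
  obtain ⟨c', hc', hmax⟩ := s.exists_max_image (fun c => ∑ a, content c a) hs
  obtain ⟨h1, h2⟩ := (Finset.mem_filter.1 hc').2
  refine ⟨c', h1, h2, fun a ha => ?_⟩
  by_contra hne
  obtain ⟨d, hd⟩ := Option.ne_none_iff_exists'.1 ha
  have hlt : content c' a < content c a + t a := lt_of_le_of_ne (h2 a) hne
  have hmem : d ∈ s := by
    refine Finset.mem_filter.2 ⟨Finset.mem_univ _, fun b => ?_, fun b => ?_⟩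
    · rw [content_f c' a d hd b]
      exact (h1 b).trans (Nat.le_add_right _ _)
    · rw [content_f c' a d hd b]
      split_ifs with hb
      · subst hb
        omega
      · exact h2 b
  have := hmax d hmem
  rw [sum_content_f hd] at this
  omega

/-- The dual of `exists_greedy_down`. -/
theorem exists_greedy_up (c : Box) (t : Fin 6 → ℕ) : ∃ c' : Box,
    (∀ a, content c' a ≤ content c a) ∧ (∀ a, content c a ≤ content c' a + t a) ∧
      ∀ a, boxCrystal.e a.succ c' ≠ none → content c a = content c' a + t a := by
  classical
  let s : Finset Box := Finset.univ.filter fun c' =>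
    (∀ a, content c' a ≤ content c a) ∧ ∀ a, content c a ≤ content c' a + t a
  have hs : s.Nonempty := ⟨c, by simp [s]⟩
  obtain ⟨c', hc', hmin⟩ := s.exists_min_image (fun c => ∑ a, content c a) hs
  obtain ⟨h1, h2⟩ := (Finset.mem_filter.1 hc').2
  refine ⟨c', h1, h2, fun a ha => ?_⟩
  by_contra hne
  obtain ⟨d, hd⟩ := Option.ne_none_iff_exists'.1 ha
  have hlt : content c a < content c' a + t a := lt_of_le_of_ne (h2 a) hne
  have hmem : d ∈ s := by
    refine Finset.mem_filter.2 ⟨Finset.mem_univ _, fun b => ?_, fun b => ?_⟩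
    · have := content_e c' a d hd b
      have := h1 b
      omega
    · have h3 := content_e c' a d hd b
      have := h2 b
      split_ifs at h3 with hb
      · subst hb
        omega
      · omega
  have := hmin d hmem
  rw [sum_content_e hd] at this
  omega

theorem greedy_down_unique {c c' c'' : Box} {t : Fin 6 → ℕ}
    (h' : ∀ a, content c' a ≤ content c a + t a)
    (hf' : ∀ a, boxCrystal.f a.succ c' ≠ none → content c' a = content c a + t a)
    (h'' : ∀ a, content c'' a ≤ content c a + t a)
    (hf'' : ∀ a, boxCrystal.f a.succ c'' ≠ none → content c'' a = content c a + t a) :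
    c' = c'' := by
  refine content_injective fun a => le_antisymm ?_ ?_
  · rcases content_le_or_exists_f c' c'' with h | ⟨d, hd, hlt⟩
    · exact h a
    · have := h' d
      have := hf'' d hd
      omega
  · rcases content_le_or_exists_f c'' c' with h | ⟨d, hd, hlt⟩
    · exact h a
    · have := h'' d
      have := hf' d hd
      omega

theorem greedy_up_unique {c c' c'' : Box} {t : Fin 6 → ℕ}
    (h' : ∀ a, content c a ≤ content c' a + t a)
    (hf' : ∀ a, boxCrystal.e a.succ c' ≠ none → content c a = content c' a + t a)
    (h'' : ∀ a, content c a ≤ content c'' a + t a)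
    (hf'' : ∀ a, boxCrystal.e a.succ c'' ≠ none → content c a = content c'' a + t a) :
    c' = c'' := by
  refine content_injective fun a => le_antisymm ?_ ?_
  · rcases content_le_or_exists_e c' c'' with h | ⟨d, hd, hlt⟩
    · exact h a
    · have := h'' d
      have := hf' d hd
      omega
  · rcases content_le_or_exists_e c'' c' with h | ⟨d, hd, hlt⟩
    · exact h a
    · have := h' d
      have := hf'' d hd
      omega

/-! ### Vacancy numbers -/

theorem area_add (i : ℕ) (μ μ' : Multiset ℕ) : area i (μ + μ') = area i μ + area i μ' := by
  simp [area]

theorem area_zero_left (μ : Multiset ℕ) : area 0 μ = 0 := by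
  simp [area]

theorem area_eq_sum {i : ℕ} {μ : Multiset ℕ} (h : ∀ k ∈ μ, k ≤ i) : area i μ = μ.sum := by
  unfold area
  rw [Multiset.map_congr rfl fun k hk => by rw [min_eq_right (h k hk)]]
  induction μ using Multiset.induction_on with
  | empty => simp
  | cons a s ih =>
    rw [Multiset.map_cons, Multiset.sum_cons, Multiset.sum_cons,
      ih fun k hk => h k (Multiset.mem_cons_of_mem hk), Nat.cast_add]

theorem area_second_difference (i : ℕ) (μ : Multiset ℕ) :
    area i μ - 2 * area (i + 1) μ + area (i + 2) μ = -(μ.count (i + 1) : ℤ) := by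
  unfold area
  induction μ using Multiset.induction_on with
  | empty => simp
  | cons a s ih =>
    simp only [Multiset.map_cons, Multiset.sum_cons, Multiset.count_cons]
    split_ifs with h
    · subst h
      push_cast at *
      omega
    · push_cast at *
      omega

theorem vacancy_zero (L : ℕ) (ν : Config) (a : Fin 6) : vacancy L ν a 0 = 0 := by
  simp [vacancy, area_zero_left]

theorem vacancy_second_difference (L : ℕ) (ν : Config) (a : Fin 6) (i : ℕ) :
    vacancy L ν a i - 2 * vacancy L ν a (i + 1) + vacancy L ν a (i + 2) =
      ∑ b, cartan₀ a b * ((ν b).count (i + 1) : ℤ) - if a = 0 ∧ i = 0 then (L : ℤ) else 0 := by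
  have h : ∑ b, cartan₀ a b * ((ν b).count (i + 1) : ℤ) = -(∑ b, cartan₀ a b * area i (ν b) -
      2 * ∑ b, cartan₀ a b * area (i + 1) (ν b) + ∑ b, cartan₀ a b * area (i + 2) (ν b)) := by
    rw [Finset.mul_sum, ← Finset.sum_sub_distrib, ← Finset.sum_add_distrib, ← Finset.sum_neg_distrib]
    refine Finset.sum_congr rfl fun b _ => ?_
    have := area_second_difference i (ν b)
    linear_combination cartan₀ a b * this
  rw [h]
  unfold vacancy
  by_cases ha : a = 0
  · rcases i with _ | i
    · simp [ha]
      ring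
    · simp [ha]
      ring
  · simp [ha]
    ring

/-- A bound for all the parts of a configuration. -/
theorem exists_part_bound (ν : Config) : ∃ N, ∀ a, ∀ k ∈ ν a, k ≤ N :=
  ⟨∑ a, (ν a).sum, fun a k hk => (Multiset.single_le_sum (fun _ _ => Nat.zero_le _) k hk).trans
    (Finset.single_le_sum (f := fun a => (ν a).sum) (fun _ _ => Nat.zero_le _) (Finset.mem_univ a))⟩

theorem vacancy_eq_of_large {L : ℕ} {ν : Config} {i : ℕ} (hi : 0 < i)
    (h : ∀ a, ∀ k ∈ ν a, k ≤ i) (a : Fin 6) :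
    vacancy L ν a i = (if a = 0 then (L : ℤ) else 0) - ∑ b, cartan₀ a b * ((ν b).sum : ℤ) := by
  unfold vacancy
  rw [min_eq_right hi]
  simp only [area_eq_sum (h _), Nat.cast_one, mul_one]

/-- For long rows the vacancy numbers are the coordinates of the weight. -/
theorem vacancy_eq_weight {L : ℕ} {lam : Weight} {ν : Config} {i : ℕ} (hi : 0 < i)
    (hw : ∀ b, ∑ a, ((ν a).sum : ℤ) * cartan₀ a b = (if b = 0 then (L : ℤ) else 0) - lam b)
    (h : ∀ a, ∀ k ∈ ν a, k ≤ i) (a : Fin 6) : vacancy L ν a i = lam a := by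
  rw [vacancy_eq_of_large hi h]
  have : ∑ b, cartan₀ a b * ((ν b).sum : ℤ) = ∑ b, ((ν b).sum : ℤ) * cartan₀ b a :=
    Finset.sum_congr rfl fun b _ => by rw [mul_comm, cartan₀_comm]
  rw [this, hw]
  ring

/-! ### Towers of vertices -/

/-- Removal of one node from every row of a partition. -/
def shorten (μ : Multiset ℕ) : Multiset ℕ := (μ.filter (fun i => 1 < i)).map (fun i => i - 1)

/-- The trace of a run of the algorithm: `S a` consists of the lengths of the rows selected in the
`a`-th partition, and `v i` is the vertex reached after the selection of all rows of length at most
`i`.  A move along arrows is recorded by the difference of the contents alone. -/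
structure Tower (v : ℕ → Box) (S : Config) : Prop where
  start : v 0 = 1
  pos : ∀ a, (S a).count 0 = 0
  step : ∀ i a, content (v (i + 1)) a = content (v i) a + (S a).count (i + 1)

theorem shorten_cons (k : ℕ) (μ : Multiset ℕ) :
    shorten (k ::ₘ μ) = (if 1 < k then {k - 1} else 0) + shorten μ := by
  unfold shorten
  rw [Multiset.filter_cons, Multiset.map_add]
  split_ifs <;> simp

theorem count_shorten (μ : Multiset ℕ) {i : ℕ} (hi : 0 < i) :
    (shorten μ).count i = μ.count (i + 1) := by
  induction μ using Multiset.induction_on with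
  | empty => simp [shorten]
  | cons k s ih =>
    rw [shorten_cons, Multiset.count_add, ih, Multiset.count_cons, add_comm]
    congr 1
    split_ifs with h1 h2 h2
    · subst h2
      simp
    · rw [Multiset.count_singleton, if_neg (by omega)]
    · omega
    · simp

theorem sum_shorten {μ : Multiset ℕ} (h : μ.count 0 = 0) :
    μ.sum = (shorten μ).sum + Multiset.card μ := by
  induction μ using Multiset.induction_on with
  | empty => simp [shorten]
  | cons k s ih =>
    rw [Multiset.count_cons] at h
    rw [shorten_cons, Multiset.sum_cons, Multiset.sum_add, ih (by omega), Multiset.card_cons]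
    have hk : k ≠ 0 := by
      rintro rfl
      simp at h
    split_ifs with h1
    · simp
      omega
    · simp
      omega

theorem map_sum_shorten (g : ℕ → ℤ) (hg : g 0 = 0) (μ : Multiset ℕ) :
    ((shorten μ).map g).sum = (μ.map fun k => g (k - 1)).sum := by
  induction μ using Multiset.induction_on with
  | empty => simp [shorten]
  | cons k s ih =>
    rw [shorten_cons, Multiset.map_add, Multiset.sum_add, ih, Multiset.map_cons, Multiset.sum_cons]
    split_ifs with h1
    · simp
    · have : k - 1 = 0 := by omega
      simp [this, hg]

theorem pos_of_mem_shorten {μ : Multiset ℕ} {k : ℕ} (h : k ∈ shorten μ) : 0 < k := by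
  simp only [shorten, Multiset.mem_map, Multiset.mem_filter] at h
  omega

namespace Tower

variable {v : ℕ → Box} {S : Config}

theorem content_zero (T : Tower v S) (a : Fin 6) : content (v 0) a = 0 := by
  rw [T.start, content_one]

theorem countP_le (T : Tower v S) (a : Fin 6) (i : ℕ) :
    (S a).countP (· ≤ i) = content (v i) a := by
  have key : ∀ (μ : Multiset ℕ) (i : ℕ),
      μ.countP (· ≤ i + 1) = μ.countP (· ≤ i) + μ.count (i + 1) := by
    intro μ i
    induction μ using Multiset.induction_on with
    | empty => simp
    | cons k s ih =>
      simp only [Multiset.countP_cons, Multiset.count_cons, ih]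
      split_ifs <;> omega
  induction i with
  | zero =>
    rw [T.content_zero]
    refine Eq.trans ?_ (T.pos a)
    rw [Multiset.count]
    exact Multiset.countP_congr rfl fun x _ => by simp [eq_comm]
  | succ i ih => rw [key, ih, T.step]

theorem area_sub (T : Tower v S) (a : Fin 6) (i : ℕ) :
    area i (S a) = area i (shorten (S a)) + content (v i) a := by
  have key : ∀ μ : Multiset ℕ, μ.count 0 = 0 →
      area i μ = area i (shorten μ) + μ.countP (· ≤ i) := by
    intro μ
    unfold area
    rw [map_sum_shorten _ (by simp)]
    induction μ using Multiset.induction_on with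
    | empty => simp
    | cons k s ih =>
      intro h
      rw [Multiset.count_cons] at h
      have ih := ih (by omega)
      have hk : k ≠ 0 := by
        rintro rfl
        simp at h
      simp only [Multiset.map_cons, Multiset.sum_cons, Multiset.countP_cons, ih]
      split_ifs <;> push_cast <;> omega
  rw [key _ (T.pos a), T.countP_le]

theorem content_mono (T : Tower v S) {i j : ℕ} (h : i ≤ j) (a : Fin 6) :
    content (v i) a ≤ content (v j) a :=
  monotone_nat_of_le_succ (f := fun i => content (v i) a)
    (fun i => by rw [T.step]; exact Nat.le_add_right _ _) h

theorem eq_of_large (T : Tower v S) {N i : ℕ} (hN : ∀ a, ∀ k ∈ S a, k ≤ N) (hi : N ≤ i) :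
    v i = v N := by
  induction i, hi using Nat.le_induction with
  | base => rfl
  | succ i hi ih =>
    rw [← ih]
    refine content_injective fun a => ?_
    rw [T.step, Multiset.count_eq_zero_of_notMem, add_zero]
    intro h
    have := hN a _ h
    omega

theorem card_eq (T : Tower v S) {N : ℕ} (hN : ∀ a, ∀ k ∈ S a, k ≤ N) (a : Fin 6) :
    Multiset.card (S a) = content (v N) a := by
  rw [← T.countP_le, eq_comm, Multiset.countP_eq_card]
  exact hN a

theorem unique {S' : Config} (T : Tower v S) (T' : Tower v S') : S = S' := by
  funext a
  ext i
  rcases i with _ | i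
  · rw [T.pos, T'.pos]
  · have := T.step i a
    have := T'.step i a
    omega

theorem pairing_succ (T : Tower v S) (i : ℕ) (a : Fin 6) :
    pairing (v (i + 1)) a =
      pairing (v i) a - ∑ b, cartan₀ a b * ((S b).count (i + 1) : ℤ) := by
  unfold pairing
  rw [sub_sub, ← Finset.sum_add_distrib]
  simp only [T.step]
  congr 1
  refine Finset.sum_congr rfl fun b _ => ?_
  push_cast
  ring

/-- Removing the nodes changes the vacancy numbers for length `i` by minus the weight of `v i`. -/
theorem vacancy_eq (T : Tower v S) (L : ℕ) (A : Config) (a : Fin 6) {i : ℕ} (hi : 0 < i) :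
    vacancy (L + 1) (fun a => A a + S a) a i =
      vacancy L (fun a => A a + shorten (S a)) a i + pairing (v i) a := by
  unfold vacancy pairing
  have h : ∀ b, cartan₀ a b * area i (A b + S b) =
      cartan₀ a b * area i (A b + shorten (S b)) + cartan₀ a b * content (v i) b := by
    intro b
    rw [area_add, area_add, T.area_sub]
    ring
  simp only [h, Finset.sum_add_distrib]
  rw [min_eq_right (show 1 ≤ i from hi)]
  split_ifs
  · push_cast
    ring
  · ring

end Tower

/-- The equation between the weights before and after the removal of one node from each selected
row. -/
theorem weight_condition_iff {v : ℕ → Box} {S : Config} (T : Tower v S) {N : ℕ}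
    (hN : ∀ a, ∀ k ∈ S a, k ≤ N) (L : ℕ) (lam : Weight) (A : Config) :
    (∀ b, ∑ a, ((A a + S a).sum : ℤ) * cartan₀ a b =
      (if b = 0 then ((L + 1 : ℕ) : ℤ) else 0) - lam b) ↔
    ∀ b, ∑ a, ((A a + shorten (S a)).sum : ℤ) * cartan₀ a b =
      (if b = 0 then (L : ℤ) else 0) - (lam - boxWt (v N)) b := by
  refine forall_congr' fun b => ?_
  have h : ∑ a, ((A a + S a).sum : ℤ) * cartan₀ a b =
      ∑ a, ((A a + shorten (S a)).sum : ℤ) * cartan₀ a b +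
        ∑ a, cartan₀ b a * content (v N) a := by
    rw [← Finset.sum_add_distrib]
    refine Finset.sum_congr rfl fun a _ => ?_
    rw [Multiset.sum_add, Multiset.sum_add, sum_shorten (T.pos a), T.card_eq hN, cartan₀_comm b a]
    push_cast
    ring
  rw [h, Pi.sub_apply, boxWt_eq_pairing, pairing]
  split_ifs <;> push_cast <;> constructor <;> intro h' <;> linarith

/-! ### Selections by the algorithm and by its inverse -/

/-- The number of singular rows of length `i` in the `a`-th partition. -/
def singular (L : ℕ) (x : Rigged) (a : Fin 6) (i : ℕ) : ℕ :=
  (x a).count (i, vacancy L (shape x) a i)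

/-- The selection `S` is the one made by the algorithm `δ`: it consists of singular rows, and all
singular rows of length `i` that could be used at `v i` are selected. -/
structure Forward (L : ℕ) (x : Rigged) (v : ℕ → Box) (S : Config) : Prop where
  le : ∀ a i, (S a).count i ≤ singular L x a i
  eq : ∀ a i, 0 < i → boxCrystal.f a.succ (v i) ≠ none → (S a).count i = singular L x a i

/-- The selection is the one made by the inverse algorithm, which runs through the vertices upwards
and lengthens singular rows, the longest ones first.  Rows of length zero are always available to it,
so that nothing is required for `i = 0`. -/
structure Backward (L : ℕ) (y : Rigged) (v : ℕ → Box) (S : Config) : Prop where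
  le : ∀ a i, 0 < i → (S a).count (i + 1) ≤ singular L y a i
  eq : ∀ a i, 0 < i → boxCrystal.e a.succ (v i) ≠ none → (S a).count (i + 1) = singular L y a i

theorem singular_le_count (L : ℕ) (x : Rigged) (a : Fin 6) (i : ℕ) :
    singular L x a i ≤ (shape x a).count i := by
  rw [singular, shape, Multiset.count_map, Multiset.count, Multiset.countP_eq_card_filter]
  refine Multiset.card_le_card (Multiset.monotone_filter_right _ ?_)
  rintro _ rfl
  rfl

theorem singular_eq_count {L : ℕ} {x : Rigged} {a : Fin 6} {i : ℕ}
    (h : ∀ s ∈ x a, 0 ≤ s.2 ∧ s.2 ≤ vacancy L (shape x) a s.1) (hi : vacancy L (shape x) a i = 0) :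
    singular L x a i = (shape x a).count i := by
  rw [singular, shape, Multiset.count_map, Multiset.count, Multiset.countP_eq_card_filter]
  congr 1
  refine Multiset.filter_congr fun s hs => ?_
  obtain ⟨k, r⟩ := s
  constructor
  · rintro ⟨⟩
    rfl
  · rintro rfl
    have := h _ hs
    simp only at this
    rw [hi] at this ⊢
    rw [le_antisymm this.2 this.1]

theorem exists_row_bound (x : Rigged) : ∃ N, ∀ a, ∀ s ∈ x a, s.1 ≤ N := by
  obtain ⟨N, hN⟩ := exists_part_bound (shape x)
  exact ⟨N, fun a s hs => hN a s.1 (Multiset.mem_map_of_mem _ hs)⟩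

theorem singular_eq_zero {L : ℕ} {x : Rigged} {N : ℕ} (hN : ∀ a, ∀ s ∈ x a, s.1 ≤ N) (a : Fin 6)
    {i : ℕ} (hi : N < i) : singular L x a i = 0 := by
  refine Multiset.count_eq_zero_of_notMem fun h => ?_
  have := hN a _ h
  simp only at this
  omega

/-- A selection exists along any increasing sequence of vertices. -/
theorem exists_tower {v : ℕ → Box} (h0 : v 0 = 1)
    (hv : ∀ i a, content (v i) a ≤ content (v (i + 1)) a) {N : ℕ} (hN : ∀ i, N ≤ i → v (i + 1) = v i) :
    ∃ S, Tower v S := by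
  have key : ∀ a i, (∑ j ∈ Finset.range N, Multiset.replicate
      (content (v (j + 1)) a - content (v j) a) (j + 1)).count (i + 1) =
      content (v (i + 1)) a - content (v i) a := by
    intro a i
    rw [Multiset.count_sum']
    simp only [Multiset.count_replicate, Nat.add_right_cancel_iff]
    rw [Finset.sum_ite_eq' (Finset.range N) i fun j => content (v (j + 1)) a - content (v j) a]
    split_ifs with hi
    · rfl
    · rw [hN i (by simpa using hi), Nat.sub_self]
  refine ⟨fun a => ∑ j ∈ Finset.range N, Multiset.replicate
      (content (v (j + 1)) a - content (v j) a) (j + 1), h0, fun a => ?_, fun i a => ?_⟩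
  · rw [Multiset.count_sum']
    simp [Multiset.count_replicate]
  · rw [key]
    have := hv i a
    omega

theorem exists_forward (L : ℕ) (x : Rigged) :
    ∃ v S, Tower v S ∧ Forward L x v S := by
  choose g hg1 hg2 hg3 using exists_greedy_down
  let v : ℕ → Box := fun i =>
    Nat.rec (1 : Box) (fun i c => g c fun a => singular L x a (i + 1)) i
  have hv : ∀ i, v (i + 1) = g (v i) fun a => singular L x a (i + 1) := fun i => rfl
  obtain ⟨N, hN⟩ := exists_row_bound x
  obtain ⟨S, T⟩ := exists_tower (v := v) rfl (fun i a => by rw [hv]; exact hg1 _ _ a) (N := N)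
    (fun i hi => content_injective fun a => le_antisymm
      (by
        have := hg2 (v i) (fun a => singular L x a (i + 1)) a
        rw [singular_eq_zero hN a (by omega)] at this
        rw [hv]
        omega)
      (by rw [hv]; exact hg1 _ _ a))
  refine ⟨v, S, T, fun a i => ?_, fun a i hi ha => ?_⟩
  · rcases i with _ | i
    · rw [T.pos]
      exact Nat.zero_le _
    · have := hg2 (v i) (fun a => singular L x a (i + 1)) a
      have := T.step i a
      rw [hv] at this
      omega
  · obtain ⟨i, rfl⟩ := Nat.exists_eq_add_one.2 hi
    rw [hv] at ha
    have := hg3 (v i) (fun a => singular L x a (i + 1)) a ha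
    have := T.step i a
    rw [hv] at this
    omega

theorem Forward.unique {L : ℕ} {x : Rigged} {v v' : ℕ → Box} {S S' : Config} (T : Tower v S)
    (T' : Tower v' S') (F : Forward L x v S) (F' : Forward L x v' S') : v = v' := by
  funext i
  induction i with
  | zero => rw [T.start, T'.start]
  | succ i ih =>
    refine greedy_down_unique (c := v i) (t := fun a => singular L x a (i + 1))
      (fun a => ?_) (fun a ha => ?_) (fun a => ?_) (fun a ha => ?_)
    · rw [T.step]
      exact Nat.add_le_add_left (F.le a _) _
    · rw [T.step, F.eq a _ (Nat.succ_pos i) ha]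
    · rw [T'.step, ih]
      exact Nat.add_le_add_left (F'.le a _) _
    · rw [T'.step, ih, F'.eq a _ (Nat.succ_pos i) ha]

theorem exists_backward (L : ℕ) (y : Rigged) (b : Box) :
    ∃ v S, Tower v S ∧ Backward L y v S ∧ ∃ N, ∀ i, N ≤ i → v i = b := by
  choose g hg1 hg2 hg3 using exists_greedy_up
  obtain ⟨N, hN⟩ := exists_row_bound y
  -- `w k` is the vertex for the length `N + 1 - k`
  let w : ℕ → Box := fun k => Nat.rec b (fun k c => g c fun a => singular L y a (N - k)) k
  let v : ℕ → Box := fun i => if i = 0 then 1 else w (N + 1 - i)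
  have hlarge : ∀ i, N + 1 ≤ i → v i = b := by
    intro i hi
    have h1 : i ≠ 0 := by omega
    have h2 : N + 1 - i = 0 := by omega
    simp [v, h1, h2, w]
  have hsmall : ∀ i, 0 < i → i ≤ N → v i = g (v (i + 1)) fun a => singular L y a i := by
    intro i hi hiN
    have h1 : N + 1 - i = (N + 1 - (i + 1)) + 1 := by omega
    have h2 : N - (N + 1 - (i + 1)) = i := by omega
    simp only [v, if_neg hi.ne', if_neg (Nat.succ_ne_zero i)]
    rw [h1]
    change g (w (N + 1 - (i + 1))) (fun a => singular L y a (N - (N + 1 - (i + 1)))) = _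
    rw [h2]
  obtain ⟨S, T⟩ := exists_tower (v := v) rfl (fun i a => by
      rcases Nat.eq_zero_or_pos i with rfl | hi
      · change content 1 a ≤ _
        rw [content_one]
        exact Nat.zero_le _
      · by_cases hiN : i ≤ N
        · rw [hsmall i hi hiN]
          exact hg1 _ _ a
        · rw [hlarge i (by omega), hlarge (i + 1) (by omega)]) (N := N + 1)
    (fun i hi => by rw [hlarge i hi, hlarge (i + 1) (by omega)])
  refine ⟨v, S, T, ⟨fun a i hi => ?_, fun a i hi ha => ?_⟩, N + 1, hlarge⟩
  · have h := T.step i a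
    by_cases hiN : i ≤ N
    · have := hg2 (v (i + 1)) (fun a => singular L y a i) a
      rw [← hsmall i hi hiN] at this
      omega
    · rw [hlarge i (by omega), hlarge (i + 1) (by omega)] at h
      omega
  · have h := T.step i a
    by_cases hiN : i ≤ N
    · have := hg3 (v (i + 1)) (fun a => singular L y a i) a
      rw [← hsmall i hi hiN] at this
      have := this ha
      omega
    · rw [hlarge i (by omega), hlarge (i + 1) (by omega)] at h
      have := singular_eq_zero (L := L) hN a (i := i) (by omega)
      omega

theorem Backward.unique {L : ℕ} {y : Rigged} {v v' : ℕ → Box} {S S' : Config} (T : Tower v S)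
    (T' : Tower v' S') (G : Backward L y v S) (G' : Backward L y v' S')
    {N : ℕ} (h : ∀ i, N ≤ i → v i = v' i) : v = v' := by
  funext i
  rcases Nat.eq_zero_or_pos i with rfl | hi
  · rw [T.start, T'.start]
  by_cases hiN : N ≤ i
  · exact h i hiN
  have hle : i ≤ N := (not_le.1 hiN).le
  clear hiN
  induction hle using Nat.decreasingInduction with
  | self => exact h N le_rfl
  | of_succ i hlt ih =>
    have ih : v (i + 1) = v' (i + 1) := ih (Nat.succ_pos i)
    refine greedy_up_unique (c := v (i + 1)) (t := fun a => singular L y a i)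
      (fun a => ?_) (fun a ha => ?_) (fun a => ?_) (fun a ha => ?_)
    · rw [T.step]
      exact Nat.add_le_add_left (G.le a _ hi) _
    · rw [T.step, G.eq a _ hi ha]
    · rw [ih, T'.step]
      exact Nat.add_le_add_left (G'.le a _ hi) _
    · rw [ih, T'.step, G'.eq a _ hi ha]

/-! ### Positivity of the vacancy numbers -/

theorem vacancy_nonneg {L : ℕ} {lam : Weight} {x : Rigged} (hx : x ∈ riggedConfigs lam L)
    (a : Fin 6) (i : ℕ) : 0 ≤ vacancy L (shape x) a i := by
  rcases Nat.eq_zero_or_pos i with rfl | hi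
  · rw [vacancy_zero]
  · exact hx.1.2.2 a i hi

/-- The selected rows of length `i + 1` weigh at least as much on `h_a` as all rows of that length
do, if the selection exhausts colour `a`. -/
theorem sum_cartan_le {a : Fin 6} {s m : Fin 6 → ℕ} (ha : s a = m a) (h : ∀ b, s b ≤ m b) :
    ∑ b, cartan₀ a b * (m b : ℤ) ≤ ∑ b, cartan₀ a b * (s b : ℤ) := by
  refine Finset.sum_le_sum fun b _ => ?_
  by_cases hb : a = b
  · rw [← hb, ha]
  · exact mul_le_mul_of_nonpos_left (by exact_mod_cast h b) (cartan₀_nonpos a b hb)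

/-- If `p_i = 0`, all rows of length `i` are singular; if moreover an arrow of colour `a` starts at
`v i`, they are all selected, and the convexity of the vacancy numbers forces the same situation for
the length `i - 1`. -/
theorem Forward.descend {L : ℕ} {lam : Weight} {x : Rigged} {v : ℕ → Box} {S : Config}
    (hx : x ∈ riggedConfigs lam (L + 1)) (T : Tower v S) (F : Forward (L + 1) x v S) {a : Fin 6}
    {i : ℕ} (hp : pairing (v (i + 1)) a = 1) (hz : vacancy (L + 1) (shape x) a (i + 1) = 0) :
    pairing (v i) a = 1 ∧ vacancy (L + 1) (shape x) a i = 0 ∧ ¬ (a = 0 ∧ i = 0) := by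
  have hs := F.eq a (i + 1) (Nat.succ_pos i) ((f_ne_none_iff _ _).2 hp)
  rw [singular_eq_count (hx.2 a) hz] at hs
  have hle := sum_cartan_le (a := a) (s := fun b => (S b).count (i + 1))
    (m := fun b => (shape x b).count (i + 1)) hs
    fun b => (F.le b _).trans (singular_le_count _ _ _ _)
  have hd := vacancy_second_difference (L + 1) (shape x) a i
  have h0 := vacancy_nonneg hx a i
  have h2 := vacancy_nonneg hx a (i + 2)
  have hw := T.pairing_succ i a
  have hm := (pairing_mem (v i) a).2
  have hL : (0 : ℤ) < ((L + 1 : ℕ) : ℤ) := by positivity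
  split_ifs at hd with hc
  · exfalso
    linarith
  · exact ⟨by linarith, by linarith, hc⟩

theorem Forward.vacancy_pos {L : ℕ} {lam : Weight} {x : Rigged} {v : ℕ → Box} {S : Config}
    (hx : x ∈ riggedConfigs lam (L + 1)) (T : Tower v S) (F : Forward (L + 1) x v S) (a : Fin 6)
    {i : ℕ} (hi : 0 < i) (hp : pairing (v i) a = 1) : 1 ≤ vacancy (L + 1) (shape x) a i := by
  obtain ⟨i, rfl⟩ := Nat.exists_eq_add_one.2 hi
  clear hi
  by_contra hlt
  have hz : vacancy (L + 1) (shape x) a (i + 1) = 0 := by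
    have := vacancy_nonneg hx a (i + 1)
    omega
  clear hlt
  induction i with
  | zero =>
    obtain ⟨h1, -, h3⟩ := F.descend hx T hp hz
    rw [T.start, pairing_one] at h1
    split_ifs at h1 with ha
    · exact h3 ⟨ha, rfl⟩
    · exact absurd h1 (by norm_num)
  | succ i ih =>
    obtain ⟨h1, h2, -⟩ := F.descend hx T hp hz
    exact ih h1 h2

/-- The dual of `Forward.descend`. -/
theorem Backward.ascend {L : ℕ} {mu : Weight} {y : Rigged} {v : ℕ → Box} {S : Config}
    (hy : y ∈ riggedConfigs mu L) (T : Tower v S) (G : Backward L y v S) {a : Fin 6}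
    {i : ℕ} (hi : 0 < i) (hp : pairing (v i) a = -1) (hz : vacancy L (shape y) a i = 0) :
    pairing (v (i + 1)) a = -1 ∧ vacancy L (shape y) a (i + 1) = 0 := by
  have hs := G.eq a i hi ((e_ne_none_iff _ _).2 hp)
  rw [singular_eq_count (hy.2 a) hz] at hs
  have hle := sum_cartan_le (a := a) (s := fun b => (S b).count (i + 1))
    (m := fun b => (shape y b).count i) hs
    fun b => (G.le b i hi).trans (singular_le_count _ _ _ _)
  have hw := T.pairing_succ i a
  have hm := (pairing_mem (v (i + 1)) a).1
  obtain ⟨i, rfl⟩ := Nat.exists_eq_add_one.2 hi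
  have hd := vacancy_second_difference L (shape y) a i
  have h0 := vacancy_nonneg hy a i
  have h2 := vacancy_nonneg hy a (i + 2)
  split_ifs at hd
  · exact ⟨by linarith, by linarith⟩
  · exact ⟨by linarith, by linarith⟩

/-- For the inverse algorithm, the forbidden situation propagates to large lengths, where the vacancy
numbers are the coordinates of the weight; there it contradicts dominance of `λ`. -/
theorem Backward.vacancy_pos {L : ℕ} {lam : Weight} (hlam : Dominant lam) {b : Box} {y : Rigged}
    {v : ℕ → Box} {S : Config} (hy : y ∈ riggedConfigs (lam - boxWt b) L) (T : Tower v S)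
    (G : Backward L y v S) {N : ℕ} (hN : ∀ i, N ≤ i → v i = b) (a : Fin 6)
    {i : ℕ} (hi : 0 < i) (hp : pairing (v i) a = -1) : 1 ≤ vacancy L (shape y) a i := by
  by_contra hlt
  have hz : vacancy L (shape y) a i = 0 := by
    have := vacancy_nonneg hy a i
    omega
  have key : ∀ k, pairing (v (i + k)) a = -1 ∧ vacancy L (shape y) a (i + k) = 0 := by
    intro k
    induction k with
    | zero => exact ⟨hp, hz⟩
    | succ k ih => exact G.ascend hy T (Nat.add_pos_left hi k) ih.1 ih.2
  obtain ⟨M, hM⟩ := exists_part_bound (shape y)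
  obtain ⟨h1, h2⟩ := key (N + M)
  rw [vacancy_eq_weight (by omega) hy.1.2.1 (fun a k hk => (hM a k hk).trans (by omega)),
    Pi.sub_apply, boxWt_eq_pairing] at h2
  rw [hN _ (by omega)] at h1
  have := hlam a
  omega

/-! ### Removing and adding nodes -/

theorem count_map_graph (g : ℕ → ℤ) (μ : Multiset ℕ) (i : ℕ) (r : ℤ) :
    (μ.map fun i => (i, g i)).count (i, r) = if r = g i then μ.count i else 0 := by
  split_ifs with h
  · rw [h]
    exact Multiset.count_map_eq_count' (fun i => (i, g i)) μ
      (fun i j hij => (Prod.ext_iff.1 hij).1) i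
  · refine Multiset.count_eq_zero_of_notMem fun hm => ?_
    obtain ⟨j, -, hj⟩ := Multiset.mem_map.1 hm
    obtain ⟨rfl, rfl⟩ := Prod.ext_iff.1 hj
    exact h rfl

theorem map_graph_le {g : ℕ → ℤ} {μ : Multiset ℕ} {X : Multiset (ℕ × ℤ)}
    (h : ∀ i, μ.count i ≤ X.count (i, g i)) : (μ.map fun i => (i, g i)) ≤ X := by
  rw [Multiset.le_iff_count]
  rintro ⟨i, r⟩
  rw [count_map_graph]
  split_ifs with hr
  · rw [hr]
    exact h i
  · exact Nat.zero_le _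

theorem map_fst_graph (g : ℕ → ℤ) (μ : Multiset ℕ) :
    (μ.map fun i => (i, g i)).map Prod.fst = μ := by
  rw [Multiset.map_map]
  exact Multiset.map_id μ

/-- The symmetric description of one step: `x` consists of the rows in `U` and of singular rows of
lengths `S`, and `y` of the rows in `U` and of the shortened rows, again singular.  The riggings in
`U` are admissible for both; for the riggings of `x` this amounts to the rule by which the algorithm
selects rows, and for those of `y` to the rule of the inverse algorithm. -/
structure Link (L : ℕ) (x y U : Rigged) (S : Config) : Prop where
  left : ∀ a, x a = U a + (S a).map fun i => (i, vacancy (L + 1) (shape x) a i)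
  right : ∀ a, y a = U a + (shorten (S a)).map fun i => (i, vacancy L (shape y) a i)
  bound : ∀ a, ∀ s ∈ U a, 0 < s.1 ∧ 0 ≤ s.2 ∧ s.2 ≤ vacancy (L + 1) (shape x) a s.1 ∧
    s.2 ≤ vacancy L (shape y) a s.1

namespace Link

variable {L : ℕ} {x y U : Rigged} {v : ℕ → Box} {S : Config}

theorem shape_left (K : Link L x y U S) : shape x = fun a => shape U a + S a := by
  funext a
  rw [shape, K.left, Multiset.map_add, map_fst_graph]
  rfl

theorem shape_right (K : Link L x y U S) : shape y = fun a => shape U a + shorten (S a) := by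
  funext a
  rw [shape, K.right, Multiset.map_add, map_fst_graph]
  rfl

theorem vacancy_eq (K : Link L x y U S) (T : Tower v S) (a : Fin 6) {i : ℕ} (hi : 0 < i) :
    vacancy (L + 1) (shape x) a i = vacancy L (shape y) a i + pairing (v i) a := by
  rw [K.shape_left, K.shape_right, T.vacancy_eq L _ a hi]

theorem singular_left (K : Link L x y U S) (a : Fin 6) (i : ℕ) :
    singular (L + 1) x a i =
      (U a).count (i, vacancy (L + 1) (shape x) a i) + (S a).count i := by
  conv_lhs => rw [singular, K.left]
  rw [Multiset.count_add, count_map_graph, if_pos rfl]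

theorem singular_right (K : Link L x y U S) (a : Fin 6) {i : ℕ} (hi : 0 < i) :
    singular L y a i =
      (U a).count (i, vacancy L (shape y) a i) + (S a).count (i + 1) := by
  conv_lhs => rw [singular, K.right]
  rw [Multiset.count_add, count_map_graph, if_pos rfl, count_shorten _ hi]

theorem forward (K : Link L x y U S) (T : Tower v S) : Forward (L + 1) x v S where
  le a i := by
    rw [K.singular_left]
    exact Nat.le_add_left _ _
  eq a i hi ha := by
    rw [K.singular_left, right_eq_add]
    refine Multiset.count_eq_zero_of_notMem fun h => ?_
    have h1 := (K.bound a _ h).2.2.2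
    simp only at h1
    rw [K.vacancy_eq T a hi, (f_ne_none_iff _ _).1 ha] at h1
    omega

theorem backward (K : Link L x y U S) (T : Tower v S) : Backward L y v S where
  le a i hi := by
    rw [K.singular_right a hi]
    exact Nat.le_add_left _ _
  eq a i hi ha := by
    rw [K.singular_right a hi, right_eq_add]
    refine Multiset.count_eq_zero_of_notMem fun h => ?_
    have h1 := (K.bound a _ h).2.2.1
    simp only at h1
    rw [K.vacancy_eq T a hi, (e_ne_none_iff _ _).1 ha] at h1
    omega

theorem newRigged_eq (K : Link L x y U S) : newRigged L x S = y := by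
  have h : newShape (shape x) S = shape y := by
    funext a
    rw [K.shape_left, K.shape_right, newShape, add_tsub_cancel_right]
    rfl
  funext a
  rw [newRigged, h, K.right]
  congr 1
  · conv_lhs => rw [K.left]
    rw [add_tsub_cancel_right]
  · rw [shorten, Multiset.map_map]
    rfl

theorem mem_right (K : Link L x y U S) (T : Tower v S) {lam : Weight}
    (hx : x ∈ riggedConfigs lam (L + 1)) {N : ℕ} (hN : ∀ a, ∀ k ∈ S a, k ≤ N)
    (hp : ∀ a i, 0 < i → 0 ≤ vacancy L (shape y) a i) :
    y ∈ riggedConfigs (lam - boxWt (v N)) L := by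
  have hw := hx.1.2.1
  rw [K.shape_left, weight_condition_iff T hN] at hw
  refine ⟨⟨fun a k hk => ?_, by rw [K.shape_right]; exact hw, hp⟩, fun a s hs => ?_⟩
  · rw [K.shape_right, Multiset.mem_add] at hk
    rcases hk with hk | hk
    · obtain ⟨s, hs, rfl⟩ := Multiset.mem_map.1 hk
      exact (K.bound a s hs).1
    · exact pos_of_mem_shorten hk
  · rw [K.right, Multiset.mem_add] at hs
    rcases hs with hs | hs
    · exact ⟨(K.bound a s hs).2.1, (K.bound a s hs).2.2.2⟩
    · obtain ⟨i, hi, rfl⟩ := Multiset.mem_map.1 hs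
      exact ⟨hp a i (pos_of_mem_shorten hi), le_rfl⟩

theorem mem_left (K : Link L x y U S) (T : Tower v S) {lam : Weight} {N : ℕ}
    (hN : ∀ a, ∀ k ∈ S a, k ≤ N) (hy : y ∈ riggedConfigs (lam - boxWt (v N)) L)
    (hp : ∀ a i, 0 < i → 0 ≤ vacancy (L + 1) (shape x) a i) :
    x ∈ riggedConfigs lam (L + 1) := by
  have hw := hy.1.2.1
  rw [K.shape_right, ← weight_condition_iff T hN] at hw
  have hS : ∀ a, ∀ k ∈ S a, 0 < k := by
    intro a k hk
    rcases Nat.eq_zero_or_pos k with rfl | h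
    · exact absurd hk (Multiset.count_eq_zero.1 (T.pos a))
    · exact h
  refine ⟨⟨fun a k hk => ?_, by rw [K.shape_left]; exact hw, hp⟩, fun a s hs => ?_⟩
  · rw [K.shape_left, Multiset.mem_add] at hk
    rcases hk with hk | hk
    · obtain ⟨s, hs, rfl⟩ := Multiset.mem_map.1 hk
      exact (K.bound a s hs).1
    · exact hS a k hk
  · rw [K.left, Multiset.mem_add] at hs
    rcases hs with hs | hs
    · exact ⟨(K.bound a s hs).2.1, (K.bound a s hs).2.2.1⟩
    · obtain ⟨i, hi, rfl⟩ := Multiset.mem_map.1 hs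
      exact ⟨hp a i (hS a i hi), le_rfl⟩

/-- The rigged configuration before the step is determined by the one after it and the selection. -/
theorem left_unique {x' U' : Rigged} (K : Link L x y U S) (K' : Link L x' y U' S) : x = x' := by
  have hU : U = U' := by
    funext a
    exact add_right_cancel ((K.right a).symm.trans (K'.right a))
  funext a
  rw [K.left, K'.left, K.shape_left, K'.shape_left, hU]

end Link

theorem Forward.link {L : ℕ} {lam : Weight} {x : Rigged} {v : ℕ → Box} {S : Config}
    (hx : x ∈ riggedConfigs lam (L + 1)) (T : Tower v S) (F : Forward (L + 1) x v S) :
    ∃ U, Link L x (newRigged L x S) U S ∧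
      ∀ a i, 0 < i → 0 ≤ vacancy L (shape (newRigged L x S)) a i := by
  let U : Rigged := fun a => x a - (S a).map fun i => (i, vacancy (L + 1) (shape x) a i)
  have hleft : ∀ a, x a = U a + (S a).map fun i => (i, vacancy (L + 1) (shape x) a i) :=
    fun a => (tsub_add_cancel_of_le (map_graph_le (F.le a))).symm
  have hsx : shape x = fun a => shape U a + S a := by
    funext a
    rw [shape, hleft, Multiset.map_add, map_fst_graph]
    rfl
  have hns : newShape (shape x) S = fun a => shape U a + shorten (S a) := by
    funext a
    rw [hsx, newShape, add_tsub_cancel_right]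
    rfl
  have hy : ∀ a, newRigged L x S a =
      U a + (shorten (S a)).map fun i => (i, vacancy L (newShape (shape x) S) a i) := by
    intro a
    rw [shorten, Multiset.map_map]
    rfl
  have hsy : shape (newRigged L x S) = newShape (shape x) S := by
    rw [hns]
    funext a
    rw [shape, hy, Multiset.map_add, map_fst_graph]
    rfl
  have hv : ∀ a i, 0 < i → vacancy (L + 1) (shape x) a i =
      vacancy L (shape (newRigged L x S)) a i + pairing (v i) a := by
    intro a i hi
    rw [hsy, hns, hsx, T.vacancy_eq L _ a hi]
  refine ⟨U, ⟨hleft, fun a => by rw [hsy]; exact hy a, fun a s hs => ?_⟩, fun a i hi => ?_⟩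
  · have hm : s ∈ x a := by
      rw [hleft]
      exact Multiset.mem_add.2 (Or.inl hs)
    have hpos : 0 < s.1 := hx.1.1 a s.1 (Multiset.mem_map_of_mem _ hm)
    have h1 := hx.2 a s hm
    refine ⟨hpos, h1.1, h1.2, ?_⟩
    have h2 := hv a s.1 hpos
    have h3 := pairing_mem (v s.1) a
    by_cases hp : pairing (v s.1) a = 1
    · -- a singular row of this length would have been selected
      have hF := F.eq a s.1 hpos ((f_ne_none_iff _ _).2 hp)
      have hne : s.2 ≠ vacancy (L + 1) (shape x) a s.1 := by
        intro h
        have hc : singular (L + 1) x a s.1 = (U a).count s + (S a).count s.1 := by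
          rw [singular, ← h]
          conv_lhs => rw [hleft]
          rw [Multiset.count_add, count_map_graph, if_pos h]
        have := Multiset.count_pos.2 hs
        omega
      omega
    · omega
  · have h2 := hv a i hi
    have h3 := pairing_mem (v i) a
    have h4 := vacancy_nonneg hx a i
    by_cases hp : pairing (v i) a = 1
    · have := F.vacancy_pos hx T a hi hp
      omega
    · omega

theorem Backward.link {L : ℕ} {lam : Weight} (hlam : Dominant lam) {b : Box} {y : Rigged}
    {v : ℕ → Box} {S : Config} (hy : y ∈ riggedConfigs (lam - boxWt b) L) (T : Tower v S)
    (G : Backward L y v S) {N : ℕ} (hN : ∀ i, N ≤ i → v i = b) :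
    ∃ x U, Link L x y U S ∧ ∀ a i, 0 < i → 0 ≤ vacancy (L + 1) (shape x) a i := by
  let U : Rigged := fun a => y a - (shorten (S a)).map fun i => (i, vacancy L (shape y) a i)
  have hright : ∀ a, y a = U a + (shorten (S a)).map fun i => (i, vacancy L (shape y) a i) := by
    refine fun a => (tsub_add_cancel_of_le (map_graph_le fun i => ?_)).symm
    rcases Nat.eq_zero_or_pos i with rfl | hi
    · rw [Multiset.count_eq_zero_of_notMem fun h => (pos_of_mem_shorten h).ne rfl]
      exact Nat.zero_le _
    · rw [count_shorten _ hi]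
      exact G.le a i hi
  have hsy : shape y = fun a => shape U a + shorten (S a) := by
    funext a
    rw [shape, hright, Multiset.map_add, map_fst_graph]
    rfl
  let x : Rigged := fun a =>
    U a + (S a).map fun i => (i, vacancy (L + 1) (fun a => shape U a + S a) a i)
  have hsx : shape x = fun a => shape U a + S a := by
    funext a
    rw [shape, Multiset.map_add, map_fst_graph]
    rfl
  have hv : ∀ a i, 0 < i → vacancy (L + 1) (shape x) a i =
      vacancy L (shape y) a i + pairing (v i) a := by
    intro a i hi
    rw [hsx, hsy, T.vacancy_eq L _ a hi]
  refine ⟨x, U, ⟨fun a => by rw [hsx], hright, fun a s hs => ?_⟩, fun a i hi => ?_⟩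
  · have hm : s ∈ y a := by
      rw [hright]
      exact Multiset.mem_add.2 (Or.inl hs)
    have hpos : 0 < s.1 := hy.1.1 a s.1 (Multiset.mem_map_of_mem _ hm)
    have h1 := hy.2 a s hm
    refine ⟨hpos, h1.1, ?_, h1.2⟩
    have h2 := hv a s.1 hpos
    have h3 := pairing_mem (v s.1) a
    by_cases hp : pairing (v s.1) a = -1
    · have hG := G.eq a s.1 hpos ((e_ne_none_iff _ _).2 hp)
      have hne : s.2 ≠ vacancy L (shape y) a s.1 := by
        intro h
        have hc : singular L y a s.1 = (U a).count s + (S a).count (s.1 + 1) := by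
          rw [singular, ← h]
          conv_lhs => rw [hright]
          rw [Multiset.count_add, count_map_graph, if_pos h, count_shorten _ hpos]
        have := Multiset.count_pos.2 hs
        omega
      omega
    · omega
  · have h2 := hv a i hi
    have h3 := pairing_mem (v i) a
    have h4 := vacancy_nonneg hy a i
    by_cases hp : pairing (v i) a = -1
    · have := G.vacancy_pos hlam hy T hN a hi hp
      omega
    · omega

/-! ### Runs of the algorithm -/

/-- A state of the algorithm on its way along the tower `v` with selection `S'`: it has dealt with the
lengths up to `k` and is selecting rows of length `k + 1`; the current vertex `b` lies between `v k`
and `v (k + 1)`. -/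
structure Along (v : ℕ → Box) (S' : Config) (b : Box) (k : ℕ) (S : Config) : Prop where
  low : ∀ a i, i ≤ k → (S a).count i = (S' a).count i
  mid : ∀ a, content b a = content (v k) a + (S a).count (k + 1)
  le : ∀ a, content b a ≤ content (v (k + 1)) a
  high : ∀ a i, k + 1 < i → (S a).count i = 0

namespace Along

variable {L : ℕ} {x : Rigged} {v : ℕ → Box} {S' S : Config} {b : Box} {k : ℕ}

theorem eq_of_blocked (A : Along v S' b k S) (T : Tower v S') (F : Forward L x v S')
    (h : ∀ a, ¬ Candidate L x b (k + 1) S a (k + 1)) : v (k + 1) = b := by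
  refine content_injective fun a => le_antisymm ?_ (A.le a)
  rcases content_le_or_exists_f (v (k + 1)) b with h1 | ⟨d, hd, hlt⟩
  · exact h1 a
  · refine absurd ⟨hd, le_rfl, ?_⟩ (h d)
    have h1 := A.mid d
    have h2 := T.step k d
    have h3 := F.le d (k + 1)
    unfold singular at h3
    omega

theorem advance (A : Along v S' b k S) (T : Tower v S') (F : Forward L x v S')
    (h : ∀ a, ¬ Candidate L x b (k + 1) S a (k + 1)) : Along v S' b (k + 1) S := by
  have hv := A.eq_of_blocked T F h
  refine ⟨fun a i hi => ?_, fun a => ?_, fun a => ?_, fun a i hi => A.high a i (by omega)⟩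
  · rcases Nat.lt_or_ge k i with h1 | h1
    · obtain rfl : i = k + 1 := by omega
      have h2 := A.mid a
      have h3 := T.step k a
      rw [hv] at h3
      omega
    · exact A.low a i h1
  · rw [hv, A.high a (k + 1 + 1) (by omega), add_zero]
  · rw [← hv]
    exact T.content_mono (Nat.le_succ _) a

theorem advance_to (A : Along v S' b k S) (T : Tower v S') (F : Forward L x v S') {j : ℕ}
    (hj : k ≤ j) (h : ∀ a i, i ≤ j → ¬ Candidate L x b (k + 1) S a i) : Along v S' b j S := by
  induction j, hj using Nat.le_induction with
  | base => exact A
  | succ j hj ih =>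
    refine (ih fun a i hi => h a i (by omega)).advance T F fun a hc => h a (j + 1) le_rfl ?_
    exact ⟨hc.1, by omega, hc.2.2⟩

theorem move (A : Along v S' b k S) (T : Tower v S') (F : Forward L x v S') {a : Fin 6} {b' : Box}
    (hb : boxCrystal.f a.succ b = some b') (hc : (S a).count (k + 1) < singular L x a (k + 1)) :
    Along v S' b' k (Function.update S a ((k + 1) ::ₘ S a)) := by
  have hcount : ∀ d i, (Function.update S a ((k + 1) ::ₘ S a) d).count i =
      (S d).count i + if d = a ∧ i = k + 1 then 1 else 0 := by
    intro d i
    by_cases hd : d = a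
    · subst hd
      simp [Multiset.count_cons]
    · simp [hd]
  have hne : boxCrystal.f a.succ b ≠ none := by simp [hb]
  refine ⟨fun d i hi => ?_, fun d => ?_, fun d => ?_, fun d i hi => ?_⟩
  · rw [hcount, if_neg (by omega), add_zero, A.low d i hi]
  · rw [hcount, content_f b a b' hb, A.mid d]
    simp [add_assoc]
  · rw [content_f b a b' hb]
    split_ifs with hd
    · subst hd
      refine Nat.lt_of_le_of_ne (A.le d) fun heq => ?_
      -- otherwise all singular rows of this colour and length are already in use
      have h1 := F.eq d (k + 1) (Nat.succ_pos k) (f_ne_none_of_content_le b _ d A.le heq hne)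
      have h2 := A.mid d
      have h3 := T.step k d
      omega
    · exact A.le d
  · rw [hcount, if_neg (by omega), A.high d i hi]

end Along

theorem Route.along {L : ℕ} {x : Rigged} {v : ℕ → Box} {S' : Config} (T : Tower v S')
    (F : Forward L x v S') {b : Box} {l : ℕ} {S : Config} (R : Route L x b l S) :
    ∃ k, l = k + 1 ∧ Along v S' b k S := by
  induction R with
  | start =>
    refine ⟨0, rfl, fun a i hi => ?_, fun a => ?_, fun a => ?_, fun a i hi => ?_⟩
    · obtain rfl : i = 0 := by omega
      rw [T.pos]
      rfl
    · rw [T.start]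
      rfl
    · rw [content_one]
      exact Nat.zero_le _
    · rfl
  | step b b' l S a i R hb hc hmin ih =>
    obtain ⟨k, rfl, A⟩ := ih
    obtain ⟨j, rfl⟩ := Nat.exists_eq_add_one.2 (show 0 < i from (Nat.succ_pos k).trans_le hc.2.1)
    have hkj : k ≤ j := by
      have := hc.2.1
      omega
    refine ⟨j, rfl, (A.advance_to T F hkj fun a' i' hi' hc' => ?_).move T F hb hc.2.2⟩
    have := hmin a' i' hc'
    omega

theorem Route.final {L : ℕ} {x : Rigged} {v : ℕ → Box} {S' : Config} (T : Tower v S')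
    (F : Forward L x v S') {b : Box} {l : ℕ} {S : Config} (R : Route L x b l S)
    (h : ∀ a i, ¬ Candidate L x b l S a i) : S = S' ∧ ∃ N, ∀ i, N ≤ i → v i = b := by
  obtain ⟨k, rfl, A⟩ := R.along T F
  have hA : ∀ j, k ≤ j → Along v S' b j S := fun j hj => A.advance_to T F hj fun a i _ => h a i
  refine ⟨?_, k + 1, fun i hi => content_injective fun a => ?_⟩
  · funext a
    ext i
    exact (hA (k + i) (by omega)).low a i (by omega)
  · rw [(hA i (by omega)).mid a, A.high a (i + 1) (by omega), add_zero]

/-- Every step increases the content, so that a run of maximal length cannot be continued. -/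
theorem exists_final_route (L : ℕ) (x : Rigged) : ∃ b l S, Route L x b l S ∧
    ∀ a i, ¬ Candidate L x b l S a i := by
  classical
  let s : Finset Box := Finset.univ.filter fun b => ∃ l S, Route L x b l S
  have hs : s.Nonempty := ⟨1, Finset.mem_filter.2 ⟨Finset.mem_univ _, 1, _, Route.start⟩⟩
  obtain ⟨b, hb, hmax⟩ := s.exists_max_image (fun c => ∑ a, content c a) hs
  obtain ⟨l, S, R⟩ := (Finset.mem_filter.1 hb).2
  refine ⟨b, l, S, R, fun a i hc => ?_⟩
  have hex : ∃ i, ∃ a, Candidate L x b l S a i := ⟨i, a, hc⟩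
  obtain ⟨a', hc'⟩ := Nat.find_spec hex
  obtain ⟨b', hb'⟩ := Option.ne_none_iff_exists'.1 hc'.1
  have R' := R.step b b' l S a' _ hb' hc' fun a'' i'' hc'' => Nat.find_min' hex ⟨a'', hc''⟩
  have := hmax b' (Finset.mem_filter.2 ⟨Finset.mem_univ _, _, _, R'⟩)
  rw [sum_content_f hb'] at this
  omega

theorem outcome_iff {L : ℕ} {x : Rigged} {v : ℕ → Box} {S : Config} (T : Tower v S)
    (F : Forward (L + 1) x v S) {N : ℕ} (hN : ∀ a, ∀ k ∈ S a, k ≤ N) (b : Box) (y : Rigged) :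
    Outcome L x b y ↔ b = v N ∧ y = newRigged L x S := by
  have key : ∀ b l S'', Route (L + 1) x b l S'' →
      (∀ a i, ¬ Candidate (L + 1) x b l S'' a i) → S'' = S ∧ b = v N := by
    intro b l S'' R h
    obtain ⟨rfl, M, hM⟩ := R.final T F h
    refine ⟨rfl, ?_⟩
    rw [← hM (N + M) (by omega), T.eq_of_large hN (by omega)]
  constructor
  · rintro ⟨l, S'', R, h, rfl⟩
    obtain ⟨rfl, rfl⟩ := key b l S'' R h
    exact ⟨rfl, rfl⟩
  · rintro ⟨rfl, rfl⟩
    obtain ⟨b, l, S'', R, h⟩ := exists_final_route (L + 1) x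
    obtain ⟨rfl, rfl⟩ := key b l S'' R h
    exact ⟨l, S'', R, h, rfl⟩

theorem gammaDelta_eq {L : ℕ} {x : Rigged} {v : ℕ → Box} {S : Config} (T : Tower v S)
    (F : Forward (L + 1) x v S) {N : ℕ} (hN : ∀ a, ∀ k ∈ S a, k ≤ N) :
    gammaDelta L x = (v N, newRigged L x S) := by
  have h : Outcome L x (gammaDelta L x).1 (gammaDelta L x).2 :=
    Classical.epsilon_spec (p := fun r : Box × Rigged => Outcome L x r.1 r.2)
      ⟨(v N, newRigged L x S), (outcome_iff T F hN _ _).2 ⟨rfl, rfl⟩⟩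
  exact Prod.ext_iff.2 ((outcome_iff T F hN _ _).1 h)

/-! ### The bijection `δ` -/

/-- One step of the algorithm, with all the data that it produces. -/
theorem exists_step {L : ℕ} {lam : Weight} {x : Rigged} (hx : x ∈ riggedConfigs lam (L + 1)) :
    ∃ v S U, ∃ N, Tower v S ∧ Forward (L + 1) x v S ∧ Link L x (gammaDelta L x).2 U S ∧
      (∀ a, ∀ k ∈ S a, k ≤ N) ∧ v N = (gammaDelta L x).1 ∧
      (gammaDelta L x).2 ∈ riggedConfigs (lam - boxWt (gammaDelta L x).1) L := by
  obtain ⟨v, S, T, F⟩ := exists_forward (L + 1) x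
  obtain ⟨N, hN⟩ := exists_part_bound S
  obtain ⟨U, K, hp⟩ := F.link hx T
  rw [gammaDelta_eq T F hN]
  exact ⟨v, S, U, N, T, F, K, hN, rfl, K.mem_right T hx hN hp⟩

/-- The coordinates of the weight are vacancy numbers. -/
theorem dominant_of_mem {L : ℕ} {lam : Weight} {x : Rigged} (hx : x ∈ riggedConfigs lam L) :
    Dominant lam := by
  intro a
  obtain ⟨N, hN⟩ := exists_part_bound (shape x)
  rw [← vacancy_eq_weight (Nat.succ_pos N) hx.1.2.1 (fun a k hk => (hN a k hk).trans (by omega)) a]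
  exact vacancy_nonneg hx a _

theorem existsUnique_outcome (L : ℕ) (x : Rigged) :
    ∃! r : Box × Rigged, Outcome L x r.1 r.2 := by
  obtain ⟨v, S, T, F⟩ := exists_forward (L + 1) x
  obtain ⟨N, hN⟩ := exists_part_bound S
  exact ⟨(v N, newRigged L x S), (outcome_iff T F hN _ _).2 ⟨rfl, rfl⟩,
    fun r hr => Prod.ext_iff.2 ((outcome_iff T F hN _ _).1 hr)⟩

theorem gammaDelta_injOn {L : ℕ} {lam mu : Weight} {x x' : Rigged}
    (hx : x ∈ riggedConfigs lam (L + 1)) (hx' : x' ∈ riggedConfigs mu (L + 1))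
    (h : gammaDelta L x = gammaDelta L x') : x = x' := by
  obtain ⟨v, S, U, N, T, -, K, hN, hv, -⟩ := exists_step hx
  obtain ⟨v', S', U', N', T', -, K', hN', hv', -⟩ := exists_step hx'
  rw [← h] at K' hv'
  have hvv : v = v' := (K.backward T).unique T T' (K'.backward T') (N := N + N') fun i hi => by
    rw [T.eq_of_large hN (by omega), T'.eq_of_large hN' (by omega), hv, hv']
  subst hvv
  obtain rfl := T.unique T'
  exact K.left_unique K'

theorem exists_of_mem {L : ℕ} {lam : Weight} (hlam : Dominant lam) {b : Box} {y : Rigged}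
    (hy : y ∈ riggedConfigs (lam - boxWt b) L) :
    ∃ x ∈ riggedConfigs lam (L + 1), gammaDelta L x = (b, y) := by
  obtain ⟨v, S, T, G, N, hN⟩ := exists_backward L y b
  obtain ⟨x, U, K, hp⟩ := G.link hlam hy T hN
  obtain ⟨M, hM⟩ := exists_part_bound S
  have hb : v M = b := by
    rw [← T.eq_of_large hM (i := M + N) (by omega), hN _ (by omega)]
  refine ⟨x, K.mem_left T hM (by rw [hb]; exact hy) hp, ?_⟩
  rw [gammaDelta_eq T (K.forward T) hM, hb, K.newRigged_eq]

theorem bijOn_delta {L : ℕ} {lam : Weight} (hlam : Dominant lam) (b : Box) :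
    Set.BijOn (fun x => (gammaDelta L x).2)
      {x | x ∈ riggedConfigs lam (L + 1) ∧ (gammaDelta L x).1 = b}
      (riggedConfigs (lam - boxWt b) L) := by
  refine ⟨fun x hx => ?_, fun x hx x' hx' h => ?_, fun y hy => ?_⟩
  · obtain ⟨v, S, U, N, -, -, -, -, -, h⟩ := exists_step hx.1
    rw [hx.2] at h
    exact h
  · exact gammaDelta_injOn hx.1 hx'.1 (Prod.ext (hx.2.trans hx'.2.symm) h)
  · obtain ⟨x, hx, h⟩ := exists_of_mem hlam hy
    exact ⟨x, ⟨hx, by rw [h]⟩, by simp only [h]⟩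

/-! ### Classically restricted paths -/

theorem CrystalOps.phi_eq {X : Type} (C : CrystalOps X) (i : Fin 7) (g : X → ℕ)
    (hs : ∀ x y, C.f i x = some y → g x = g y + 1) (hn : ∀ x, C.f i x = none → g x = 0) (x : X) :
    C.phi i x = g x := by
  have key : ∀ k x, iter (C.f i) k x ≠ none ↔ k ≤ g x := by
    intro k
    induction k with
    | zero => simp [iter]
    | succ k ih =>
      intro x
      rcases hx : C.f i x with _ | y
      · simp [iter, hx, hn x hx]
      · have := ih y
        simp only [iter, hx, Option.bind_some, hs x y hx, this]
        omega
  have : {k | iter (C.f i) k x ≠ none} = Set.Iic (g x) := Set.ext fun k => key k x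
  rw [CrystalOps.phi, this, csSup_Iic]

theorem box_f_some : ∀ (i : Fin 7) (b b' : Box), boxCrystal.f i b = some b' →
    boxCrystal.e i b = none ∧ boxCrystal.f i b' = none ∧ (boxCrystal.e i b').isSome = true := by
  decide +kernel

theorem pathCrystal_f (L : ℕ) (i : Fin 7) (p : Path (L + 1)) :
    (pathCrystal (L + 1)).f i p =
      if boxCrystal.eps i (p (Fin.last L)) < (pathCrystal L).phi i (Fin.init p) then
        ((pathCrystal L).f i (Fin.init p)).map
          (fun q => (Fin.snoc q (p (Fin.last L)) : Path (L + 1)))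
      else (boxCrystal.f i (p (Fin.last L))).map
          (fun b => (Fin.snoc (Fin.init p) b : Path (L + 1))) := by
  rw [pathCrystal]
  simp only [CrystalOps.tensor]
  split_ifs <;> rw [Option.map_map] <;> rfl

theorem pathCrystal_e_eq_none (L : ℕ) (i : Fin 7) (p : Path (L + 1)) :
    (pathCrystal (L + 1)).e i p = none ↔
      boxCrystal.eps i (p (Fin.last L)) ≤ (pathCrystal L).phi i (Fin.init p) ∧
        (pathCrystal L).e i (Fin.init p) = none := by
  rw [pathCrystal]
  simp only [CrystalOps.tensor]
  split_ifs with h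
  · simp [h]
  · have : boxCrystal.e i (p (Fin.last L)) ≠ none := by
      intro h'
      rw [box_eps, h'] at h
      simp at h
    simp [h, this]

/-- The length of the `i`-string below a path, by the tensor product rule. -/
theorem phi_path_law (i : Fin 7) (L : ℕ) :
    (∀ p q, (pathCrystal L).f i p = some q →
      (pathCrystal L).phi i p = (pathCrystal L).phi i q + 1) ∧
    (∀ p, (pathCrystal L).f i p = none → (pathCrystal L).phi i p = 0) ∧
    ∀ n, L = n + 1 → ∀ p : Path (n + 1), (pathCrystal (n + 1)).phi i p =
      boxCrystal.phi i (p (Fin.last n)) +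
        ((pathCrystal n).phi i (Fin.init p) - boxCrystal.eps i (p (Fin.last n))) := by
  induction L with
  | zero =>
    have h : ∀ p, (pathCrystal 0).phi i p = 0 :=
      CrystalOps.phi_eq _ i (fun _ => 0) (fun p q h => by simp [pathCrystal] at h) fun _ _ => rfl
    exact ⟨fun p q hq => by simp [pathCrystal] at hq, fun p _ => h p, fun n hn => by omega⟩
  | succ L ih =>
    obtain ⟨ih1, ih2, -⟩ := ih
    let g : Path (L + 1) → ℕ := fun p => boxCrystal.phi i (p (Fin.last L)) +
      ((pathCrystal L).phi i (Fin.init p) - boxCrystal.eps i (p (Fin.last L)))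
    have hs : ∀ p q, (pathCrystal (L + 1)).f i p = some q → g p = g q + 1 := by
      intro p q hq
      rw [pathCrystal_f] at hq
      split_ifs at hq with hc
      · obtain ⟨r, hr, rfl⟩ := Option.map_eq_some_iff.1 hq
        simp only [g, Fin.snoc_last, Fin.init_snoc]
        have := ih1 _ _ hr
        omega
      · obtain ⟨b, hb, rfl⟩ := Option.map_eq_some_iff.1 hq
        simp only [g, Fin.snoc_last, Fin.init_snoc]
        obtain ⟨h1, h2, h3⟩ := box_f_some i _ _ hb
        simp only [box_phi, box_eps, hb, h1, h2, h3] at hc ⊢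
        simp at hc ⊢
        omega
    have hn : ∀ p, (pathCrystal (L + 1)).f i p = none → g p = 0 := by
      intro p hp
      rw [pathCrystal_f] at hp
      split_ifs at hp with hc
      · rw [Option.map_eq_none_iff] at hp
        have := ih2 _ hp
        omega
      · rw [Option.map_eq_none_iff] at hp
        simp only [g]
        rw [box_phi, hp]
        simp
        omega
    have hg := CrystalOps.phi_eq _ i g hs hn
    refine ⟨fun p q h => by rw [hg, hg]; exact hs p q h, fun p h => by rw [hg]; exact hn p h, ?_⟩
    rintro n ⟨⟩ p
    exact hg p

theorem phi_path_succ (i : Fin 7) (L : ℕ) (p : Path (L + 1)) :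
    (pathCrystal (L + 1)).phi i p = boxCrystal.phi i (p (Fin.last L)) +
      ((pathCrystal L).phi i (Fin.init p) - boxCrystal.eps i (p (Fin.last L))) :=
  (phi_path_law i (L + 1)).2.2 L rfl p

theorem phi_path_zero (i : Fin 7) (p : Path 0) : (pathCrystal 0).phi i p = 0 :=
  (phi_path_law i 0).2.1 p rfl

theorem pathWt_succ {L : ℕ} (p : Path (L + 1)) :
    pathWt p = pathWt (Fin.init p) + boxWt (p (Fin.last L)) := by
  rw [pathWt, Fin.sum_univ_castSucc]
  rfl

/-- At the upper end of a string, its length is the value of the coroot on the weight. -/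
theorem phi_eq_pathWt {L : ℕ} (a : Fin 6) (p : Path L) (h : (pathCrystal L).e a.succ p = none) :
    ((pathCrystal L).phi a.succ p : ℤ) = pathWt p a := by
  induction L with
  | zero => simp [phi_path_zero, pathWt]
  | succ L ih =>
    obtain ⟨h1, h2⟩ := (pathCrystal_e_eq_none L a.succ p).1 h
    have := ih (Fin.init p) h2
    rw [phi_path_succ, pathWt_succ, Pi.add_apply, ← this, boxWt]
    omega

theorem mem_paths_succ {L : ℕ} {lam : Weight} (hlam : Dominant lam) (p : Path (L + 1)) :
    p ∈ paths lam (L + 1) ↔ Fin.init p ∈ paths (lam - boxWt (p (Fin.last L))) L := by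
  have hwt : pathWt p = lam ↔ pathWt (Fin.init p) = lam - boxWt (p (Fin.last L)) := by
    rw [pathWt_succ, eq_sub_iff_add_eq]
  constructor
  · rintro ⟨h1, h2⟩
    exact ⟨hwt.1 h1, fun a => ((pathCrystal_e_eq_none L a.succ p).1 (h2 a)).2⟩
  · rintro ⟨h1, h2⟩
    refine ⟨hwt.2 h1, fun a => (pathCrystal_e_eq_none L a.succ p).2 ⟨?_, h2 a⟩⟩
    have h3 := phi_eq_pathWt a _ (h2 a)
    rw [h1, Pi.sub_apply, boxWt_eq_pairing] at h3
    have h4 := hlam a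
    rw [box_eps]
    split_ifs with he
    · have h5 : pairing (p (Fin.last L)) a = -1 := by
        rw [← e_ne_none_iff]
        intro h
        rw [h] at he
        simp at he
      omega
    · exact Nat.zero_le _

/-! ### The bijection `Φ` -/

/-- For `L = 0` the only rigged configuration is the empty one. -/
theorem eq_zero_of_mem_zero {mu : Weight} {x : Rigged} (hx : x ∈ riggedConfigs mu 0) :
    (∀ a, x a = 0) ∧ mu = 0 := by
  have hmu := dominant_of_mem hx
  have hw := hx.1.2.1
  have hsum : ∀ a, (shape x a).sum = 0 := by
    -- the inverse of the Cartan matrix has positive entries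
    have e0 := hw 0
    have e1 := hw 1
    have e2 := hw 2
    have e3 := hw 3
    have e4 := hw 4
    have e5 := hw 5
    have d0 := hmu 0
    have d1 := hmu 1
    have d2 := hmu 2
    have d3 := hmu 3
    have d4 := hmu 4
    have d5 := hmu 5
    simp [Fin.sum_univ_six, cartan₀_eq, -Nat.cast_multiset_sum] at e0 e1 e2 e3 e4 e5
    intro a
    fin_cases a <;> simp <;> omega
  have hx0 : ∀ a, x a = 0 := by
    intro a
    refine Multiset.eq_zero_of_forall_notMem fun s hs => ?_
    have hm : s.1 ∈ shape x a := Multiset.mem_map_of_mem _ hs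
    have h1 := hx.1.1 a s.1 hm
    have h2 := Multiset.single_le_sum (fun _ _ => Nat.zero_le _) s.1 hm
    rw [hsum a] at h2
    omega
  refine ⟨hx0, ?_⟩
  funext b
  have := hw b
  simp only [hsum] at this
  simp at this
  simp [this]

theorem zero_mem_zero : (fun _ => 0 : Rigged) ∈ riggedConfigs 0 0 := by
  refine ⟨⟨fun a k hk => by simp [shape] at hk, fun b => by simp [shape], fun a i hi => ?_⟩,
    fun a s hs => by simp at hs⟩
  simp [vacancy, shape, area]

theorem bijOn_Phi (L : ℕ) {lam : Weight} (hlam : Dominant lam) :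
    Set.BijOn (Phi L) (riggedConfigs lam L) (paths lam L) := by
  induction L generalizing lam with
  | zero =>
    have hmem : ∀ p : Path 0, p ∈ paths lam 0 ↔ lam = 0 := by
      intro p
      simp [paths, pathWt, pathCrystal, eq_comm]
    refine ⟨fun x hx => ?_, fun x hx x' hx' _ => ?_, fun p hp => ?_⟩
    · exact (hmem _).2 (eq_zero_of_mem_zero hx).2
    · funext a
      rw [(eq_zero_of_mem_zero hx).1, (eq_zero_of_mem_zero hx').1]
    · rw [(hmem p).1 hp]
      exact ⟨_, zero_mem_zero, Subsingleton.elim _ _⟩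
  | succ L ih =>
    have hstep : ∀ x ∈ riggedConfigs lam (L + 1),
        (gammaDelta L x).2 ∈ riggedConfigs (lam - boxWt (gammaDelta L x).1) L := by
      intro x hx
      exact (bijOn_delta hlam _).mapsTo ⟨hx, rfl⟩
    refine ⟨fun x hx => ?_, fun x hx x' hx' h => ?_, fun p hp => ?_⟩
    · rw [mem_paths_succ hlam, Phi, Fin.init_snoc, Fin.snoc_last]
      exact (ih (dominant_of_mem (hstep x hx))).mapsTo (hstep x hx)
    · rw [Phi, Phi] at h
      have h1 := congrArg (fun p : Path (L + 1) => p (Fin.last L)) h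
      have h2 := congrArg (fun p : Path (L + 1) => (Fin.init p : Path L)) h
      simp only [Fin.snoc_last, Fin.init_snoc] at h1 h2
      have h3 := hstep x' hx'
      rw [← h1] at h3
      exact gammaDelta_injOn hx hx'
        (Prod.ext h1 ((ih (dominant_of_mem h3)).injOn (hstep x hx) h3 h2))
    · rw [mem_paths_succ hlam] at hp
      have hdom : Dominant (lam - boxWt (p (Fin.last L))) := by
        intro a
        rw [← hp.1, ← phi_eq_pathWt a _ (hp.2 a)]
        positivity
      obtain ⟨y, hy, hyp⟩ := (ih hdom).surjOn hp
      obtain ⟨x, hx, hxy⟩ := exists_of_mem hlam hy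
      refine ⟨x, hx, ?_⟩
      rw [Phi, hxy, hyp]
      exact Fin.snoc_init_self p

/-! ### The change of the charge -/

/-- The symmetric bilinear form on configurations whose half is the quadratic part of the charge. -/
def form (ν ν' : Config) : ℤ := ∑ a, ∑ b, cartan₀ a b * minPair (ν a) (ν' b)

theorem minPair_add_left (μ₁ μ₂ μ' : Multiset ℕ) :
    minPair (μ₁ + μ₂) μ' = minPair μ₁ μ' + minPair μ₂ μ' := by
  simp [minPair]

theorem form_add_left (ν₁ ν₂ ν' : Config) :
    form (fun a => ν₁ a + ν₂ a) ν' = form ν₁ ν' + form ν₂ ν' := by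
  simp only [form, minPair_add_left, mul_add, Finset.sum_add_distrib]

theorem form_comm (ν ν' : Config) : form ν ν' = form ν' ν := by
  unfold form
  rw [Finset.sum_comm]
  refine Finset.sum_congr rfl fun b _ => Finset.sum_congr rfl fun a _ => ?_
  rw [cartan₀_comm, minPair_comm]

theorem form_add_right (ν ν₁ ν₂ : Config) :
    form ν (fun a => ν₁ a + ν₂ a) = form ν ν₁ + form ν ν₂ := by
  rw [form_comm, form_add_left, form_comm ν₁, form_comm ν₂]

theorem sum_min_one {μ : Multiset ℕ} (h : ∀ k ∈ μ, 0 < k) :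
    (μ.map fun k => ((min 1 k : ℕ) : ℤ)).sum = Multiset.card μ := by
  rw [Multiset.map_congr rfl fun k hk => by rw [min_eq_left (h k hk)]]
  simp

theorem two_mul_charge {L : ℕ} {ν : Config} (h : ∀ k ∈ ν 0, 0 < k) :
    2 * charge L ν = form ν ν - 2 * L * Multiset.card (ν 0) := by
  unfold charge
  rw [sum_min_one h, mul_sub, two_mul_half, form]
  ring

theorem sum_vacancy (L : ℕ) (ν : Config) (a : Fin 6) {μ : Multiset ℕ} (h : ∀ k ∈ μ, 0 < k) :
    (μ.map (vacancy L ν a)).sum =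
      (if a = 0 then (L : ℤ) * Multiset.card μ else 0) - ∑ b, cartan₀ a b * minPair μ (ν b) := by
  induction μ using Multiset.induction_on with
  | empty => simp [minPair]
  | cons k s ih =>
    have hk := h k (Multiset.mem_cons_self k s)
    have hm : ∀ b, cartan₀ a b * minPair (k ::ₘ s) (ν b) =
        cartan₀ a b * area k (ν b) + cartan₀ a b * minPair s (ν b) := by
      intro b
      simp [minPair, mul_add]
    rw [Multiset.map_cons, Multiset.sum_cons, ih fun j hj => h j (Multiset.mem_cons_of_mem hj),
      vacancy, min_eq_right (show 1 ≤ k from hk)]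
    simp only [hm, Finset.sum_add_distrib, Multiset.card_cons]
    split_ifs <;> push_cast <;> ring

theorem sum_sum_vacancy (L : ℕ) (ν : Config) {S : Config} (h : ∀ a, ∀ k ∈ S a, 0 < k) :
    ∑ a, ((S a).map (vacancy L ν a)).sum = (L : ℤ) * Multiset.card (S 0) - form S ν := by
  simp only [sum_vacancy L ν _ (h _), Finset.sum_sub_distrib, form]
  rw [Finset.sum_ite_eq' Finset.univ (0 : Fin 6) fun a => (L : ℤ) * Multiset.card (S a),
    if_pos (Finset.mem_univ _)]

theorem sum_map_eq_sum_range {μ : Multiset ℕ} (h0 : μ.count 0 = 0) {N : ℕ} (hN : ∀ k ∈ μ, k ≤ N)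
    (g : ℕ → ℤ) : (μ.map g).sum = ∑ i ∈ Finset.range N, (μ.count (i + 1) : ℤ) * g (i + 1) := by
  rw [Finset.sum_multiset_map_count, Finset.sum_subset (s₂ := Finset.range (N + 1))]
  · rw [Finset.sum_range_succ', h0]
    simp
  · intro k hk
    have := hN k (Multiset.mem_toFinset.1 hk)
    simp
    omega
  · intro k _ hk
    rw [Multiset.count_eq_zero_of_notMem fun h => hk (Multiset.mem_toFinset.2 h), zero_smul]

/-- The sum over the selected rows telescopes, because all weights of `B` have the same length. -/
theorem Tower.form_sub {v : ℕ → Box} {S : Config} (T : Tower v S) :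
    form S S = form (fun a => shorten (S a)) (fun a => shorten (S a)) +
      2 * Multiset.card (S 0) := by
  obtain ⟨N, hN⟩ := exists_part_bound S
  have h1 : ∀ a b, minPair (S a) (S b) = minPair (S a) (shorten (S b)) +
      ((S a).map fun k => (content (v k) b : ℤ)).sum := by
    intro a b
    simp only [minPair, T.area_sub b, Multiset.sum_map_add]
  have h2 : ∀ a b, minPair (S a) (shorten (S b)) = minPair (shorten (S a)) (shorten (S b)) +
      ((S b).map fun k => (content (v (k - 1)) a : ℤ)).sum := by
    intro a b
    rw [minPair_comm, minPair_comm (shorten (S a))]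
    simp only [minPair, T.area_sub a, Multiset.sum_map_add]
    rw [map_sum_shorten (fun k => (content (v k) a : ℤ)) (by simp [T.content_zero])]
  have h3 : ∀ a b, minPair (S a) (S b) = minPair (shorten (S a)) (shorten (S b)) +
      ∑ i ∈ Finset.range N, ((content (v (i + 1)) a : ℤ) * content (v (i + 1)) b -
        content (v i) a * content (v i) b) := by
    intro a b
    rw [h1, h2, sum_map_eq_sum_range (T.pos a) (hN a), sum_map_eq_sum_range (T.pos b) (hN b),
      add_assoc, ← Finset.sum_add_distrib]
    congr 1
    refine Finset.sum_congr rfl fun i _ => ?_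
    rw [T.step i a, T.step i b, Nat.add_sub_cancel]
    push_cast
    ring
  have h4 : ∀ a b, minPair (S a) (S b) = minPair (shorten (S a)) (shorten (S b)) +
      (content (v N) a : ℤ) * content (v N) b := by
    intro a b
    rw [h3, Finset.sum_range_sub fun i => (content (v i) a : ℤ) * content (v i) b]
    simp [T.content_zero]
  simp only [form, h4, mul_add, Finset.sum_add_distrib]
  rw [content_norm, T.card_eq hN]

theorem card_shorten {μ : Multiset ℕ} (h : μ.count 0 = 0) :
    Multiset.card μ = Multiset.card (shorten μ) + μ.count 1 := by
  induction μ using Multiset.induction_on with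
  | empty => simp [shorten]
  | cons k s ih =>
    rw [Multiset.count_cons] at h
    have hk : k ≠ 0 := by
      rintro rfl
      simp at h
    rw [shorten_cons, Multiset.card_cons, Multiset.card_add, ih (by omega), Multiset.count_cons]
    split_ifs
    · omega
    · simp
      omega
    · simp
      omega
    · omega

theorem Link.riggedCharge_eq {L : ℕ} {lam mu : Weight} {x y U : Rigged} {v : ℕ → Box} {S : Config}
    (K : Link L x y U S) (T : Tower v S) (hx : x ∈ riggedConfigs lam (L + 1))
    (hy : y ∈ riggedConfigs mu L) :
    riggedCharge (L + 1) x = riggedCharge L y - Multiset.card (x 0) := by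
  have hS : ∀ a, ∀ k ∈ S a, 0 < k := by
    intro a k hk
    refine hx.1.1 a k ?_
    rw [K.shape_left]
    exact Multiset.mem_add.2 (Or.inr hk)
  have hcx := two_mul_charge (L := L + 1) (hx.1.1 0)
  have hcy := two_mul_charge (L := L) (hy.1.1 0)
  have hJx : ∑ a, ((x a).map Prod.snd).sum = ∑ a, ((U a).map Prod.snd).sum +
      ∑ a, ((S a).map (vacancy (L + 1) (shape x) a)).sum := by
    rw [← Finset.sum_add_distrib]
    refine Finset.sum_congr rfl fun a _ => ?_
    conv_lhs => rw [K.left]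
    rw [Multiset.map_add, Multiset.sum_add, Multiset.map_map]
    rfl
  have hJy : ∑ a, ((y a).map Prod.snd).sum = ∑ a, ((U a).map Prod.snd).sum +
      ∑ a, ((shorten (S a)).map (vacancy L (shape y) a)).sum := by
    rw [← Finset.sum_add_distrib]
    refine Finset.sum_congr rfl fun a _ => ?_
    conv_lhs => rw [K.right]
    rw [Multiset.map_add, Multiset.sum_add, Multiset.map_map]
    rfl
  rw [sum_sum_vacancy _ _ hS] at hJx
  rw [sum_sum_vacancy L (shape y) (S := fun a => shorten (S a))
    fun a k hk => pos_of_mem_shorten hk] at hJy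
  have hcard : Multiset.card (x 0) = Multiset.card (shape U 0) + Multiset.card (S 0) := by
    conv_lhs => rw [K.left]
    simp [shape]
  have hT := T.form_sub
  rw [K.shape_left] at hcx hJx
  rw [K.shape_right] at hcy hJy
  simp only [form_add_left, form_add_right, Multiset.card_add] at hcx hcy hJx hJy
  rw [form_comm S (shape U)] at hcx hJx
  rw [form_comm (fun a => shorten (S a)) (shape U)] at hcy hJy
  unfold riggedCharge
  rw [hJx, hJy, hcard, K.shape_left, K.shape_right]
  push_cast at *
  linarith

/-! ### The local energy of two successive vertices -/

/-- The local energy of the pair of vertices reached by `δ` on `x` for the length `i + 1` and on `δ x`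
for the length `i` does not depend on `i`. -/
theorem energyDigit_tower {L : ℕ} {y : Rigged} {v v' : ℕ → Box} {S S' : Config} (T : Tower v S)
    (T' : Tower v' S') (G : Backward L y v S) (F : Forward L y v' S') (i : ℕ) :
    energyDigit (v' i) (v (i + 1)) = content (v 1) 0 := by
  induction i with
  | zero => rw [T'.start, energyDigit_one]
  | succ i ih =>
    rw [← ih]
    refine (energyDigit_eq_of_forall fun n => ⟨fun h => ?_, fun h => ?_⟩).symm
    · rcases exists_f_of_not_le n (v (i + 1 + 1)) (v' (i + 1)) with h1 | ⟨a, ha, hlt⟩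
      · exact h1
      · have h1 := T.step (i + 1) a
        have h2 := T'.step i a
        have h3 := F.eq a (i + 1) (Nat.succ_pos i) ha
        have h4 := G.le a (i + 1) (Nat.succ_pos i)
        have h5 := h a
        omega
    · rcases exists_e_of_not_le n (v (i + 1)) (v' i) with h1 | ⟨a, ha, hlt⟩
      · exact h1
      · have h1 := T.step (i + 1) a
        have h2 := T'.step i a
        have h3 := G.eq a (i + 1) (Nat.succ_pos i) ha
        have h4 := F.le a (i + 1)
        have h5 := h a
        omega

theorem localEnergy_gammaDelta {L : ℕ} {lam : Weight} {x : Rigged}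
    (hx : x ∈ riggedConfigs lam (L + 2)) :
    localEnergy (gammaDelta L (gammaDelta (L + 1) x).2).1 (gammaDelta (L + 1) x).1 =
      Multiset.card ((gammaDelta (L + 1) x).2 0) - Multiset.card (x 0) := by
  obtain ⟨v, S, U, N, T, -, K, hN, hv, hy⟩ := exists_step hx
  obtain ⟨v', S', -, N', T', F', -, hN', hv', -⟩ := exists_step hy
  have h := energyDigit_tower T T' (K.backward T) F' (N + N')
  rw [T'.eq_of_large hN' (by omega), T.eq_of_large hN (by omega), hv, hv'] at h
  have hx0 : Multiset.card (x 0) = Multiset.card (U 0) + Multiset.card (S 0) := by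
    conv_lhs => rw [K.left]
    simp
  have hy0 : Multiset.card ((gammaDelta (L + 1) x).2 0) =
      Multiset.card (U 0) + Multiset.card (shorten (S 0)) := by
    conv_lhs => rw [K.right]
    simp
  have h1 := T.step 0 0
  rw [T.content_zero] at h1
  have h2 := card_shorten (T.pos 0)
  rw [localEnergy_eq, h]
  simp only [zero_add] at h1
  omega

/-- The sum of the local energies of all pairs of neighbouring vertices of a path. -/
noncomputable def pairEnergy : {L : ℕ} → Path L → ℤ
  | 0, _ => 0
  | n + 1, p => ∑ j : Fin n, localEnergy (p j.castSucc) (p j.succ)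

theorem snoc_succ {n : ℕ} (p : Path (n + 1)) (b : Box) (j : Fin n) :
    (Fin.snoc p b : Path (n + 2)) j.castSucc.succ = p j.succ := by
  rw [← Fin.castSucc_succ]
  exact Fin.snoc_castSucc (α := fun _ => Box) b p j.succ

theorem snoc_castSucc' {n : ℕ} (p : Path n) (b : Box) (j : Fin n) :
    (Fin.snoc p b : Path (n + 1)) j.castSucc = p j :=
  Fin.snoc_castSucc (α := fun _ => Box) b p j

theorem snoc_last' {n : ℕ} (p : Path n) (b : Box) :
    (Fin.snoc p b : Path (n + 1)) (Fin.last n) = b :=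
  Fin.snoc_last (α := fun _ => Box) b p

theorem pairEnergy_snoc {n : ℕ} (p : Path (n + 1)) (b : Box) :
    pairEnergy (Fin.snoc p b : Path (n + 2)) =
      pairEnergy p + localEnergy (p (Fin.last n)) b := by
  simp only [pairEnergy]
  rw [Fin.sum_univ_castSucc]
  simp only [snoc_succ, snoc_castSucc', Fin.succ_last, snoc_last']

theorem energy_snoc {L : ℕ} (p : Path L) (b : Box) :
    energy (Fin.snoc p b : Path (L + 1)) = energy p + pairEnergy (Fin.snoc p b : Path (L + 1)) := by
  rcases L with _ | n
  · simp [energy, pairEnergy]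
  · rw [pairEnergy_snoc]
    simp only [energy, pairEnergy]
    rw [Fin.sum_univ_castSucc, ← add_assoc, ← Finset.sum_add_distrib]
    congr 1
    · refine Finset.sum_congr rfl fun j _ => ?_
      rw [snoc_succ, snoc_castSucc', Fin.val_castSucc]
      push_cast
      ring
    · rw [snoc_castSucc', Fin.succ_last, snoc_last', Fin.val_last]
      push_cast
      ring

/-- The charge is the energy; at the same time the number of rows of the first partition is minus the
sum of the local energies of neighbouring vertices. -/
theorem riggedCharge_eq_energy {L : ℕ} {lam : Weight} {x : Rigged} (hx : x ∈ riggedConfigs lam L) :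
    riggedCharge L x = energy (Phi L x) ∧
      pairEnergy (Phi L x) = -(Multiset.card (x 0) : ℤ) := by
  induction L generalizing lam x with
  | zero =>
    have h0 := (eq_zero_of_mem_zero hx).1
    refine ⟨?_, by simp [pairEnergy, h0]⟩
    simp [riggedCharge, charge, energy, shape, h0, minPair]
  | succ L ih =>
    obtain ⟨v, S, U, N, T, F, K, hN, hv, hy⟩ := exists_step hx
    obtain ⟨ih1, ih2⟩ := ih hy
    have key : pairEnergy (Phi (L + 1) x) = -(Multiset.card (x 0) : ℤ) := by
      rw [Phi]
      rcases L with _ | n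
      · -- here `γ(x) = 1`, since its weight is dominant, and `x` has no rows at all
        obtain ⟨h0, hmu⟩ := eq_zero_of_mem_zero hy
        have h1 : (gammaDelta 0 x).1 = 1 := by
          refine eq_one_of_pairing_nonneg _ fun a => ?_
          rw [← boxWt_eq_pairing, ← sub_eq_zero.1 hmu]
          exact dominant_of_mem hx a
        have hS := T.card_eq hN 0
        rw [hv, h1, content_one] at hS
        have hU : Multiset.card (U 0) = 0 := by
          have := congrArg Multiset.card ((K.right 0).symm.trans (h0 0))
          simp only [Multiset.card_add, Multiset.card_zero] at this
          omega
        have hx0 : Multiset.card (x 0) = 0 := by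
          rw [K.left]
          simp [hU, hS]
        simp [pairEnergy, hx0]
      · rw [pairEnergy_snoc, ih2]
        have h1 : Phi (n + 1) (gammaDelta (n + 1) x).2 (Fin.last n) =
            (gammaDelta n (gammaDelta (n + 1) x).2).1 := by
          rw [Phi, snoc_last']
        rw [h1, localEnergy_gammaDelta hx]
        ring
    refine ⟨?_, key⟩
    rw [K.riggedCharge_eq T hx hy, ih1]
    rw [Phi] at key ⊢
    rw [energy_snoc, key]
    ring

/-! ### The fermionic formula -/

/-- The set `A` is finite, and `P` is its generating function with respect to the statistic `w`. -/
def HasGenFun {α : Type} (A : Set α) (w : α → ℤ) (P : LaurentPolynomial ℤ) : Prop :=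
  ∃ t : Finset α, (t : Set α) = A ∧ ∑ x ∈ t, LaurentPolynomial.T (w x) = P

theorem T_sum {ι : Type} (s : Finset ι) (f : ι → ℤ) :
    (LaurentPolynomial.T (∑ i ∈ s, f i) : LaurentPolynomial ℤ) =
      ∏ i ∈ s, LaurentPolynomial.T (f i) := by
  classical
  induction s using Finset.induction_on with
  | empty => simp
  | insert a s ha ih => rw [Finset.sum_insert ha, Finset.prod_insert ha, LaurentPolynomial.T_add, ih]

namespace HasGenFun

variable {α β : Type} {A A' : Set α} {B : Set β} {w : α → ℤ} {w' : β → ℤ}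
  {P Q : LaurentPolynomial ℤ}

theorem finite (h : HasGenFun A w P) : A.Finite := by
  obtain ⟨t, rfl, -⟩ := h
  exact t.finite_toSet

theorem finsum_eq (h : HasGenFun A w P) : ∑ᶠ x ∈ A, LaurentPolynomial.T (w x) = P := by
  obtain ⟨t, rfl, ht⟩ := h
  rw [finsum_mem_coe_finset, ht]

theorem of_bijOn (h : HasGenFun A w P) {f : α → β} (hf : Set.BijOn f A B) {c : ℤ}
    (hw : ∀ x ∈ A, w' (f x) = c + w x) : HasGenFun B w' (LaurentPolynomial.T c * P) := by
  classical
  obtain ⟨t, rfl, rfl⟩ := h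
  refine ⟨t.image f, by rw [Finset.coe_image, hf.image_eq], ?_⟩
  rw [Finset.sum_image hf.injOn, Finset.mul_sum]
  exact Finset.sum_congr rfl fun x hx => by rw [hw x hx, LaurentPolynomial.T_add]

theorem union (h : HasGenFun A w P) (h' : HasGenFun A' w Q) (hd : Disjoint A A') :
    HasGenFun (A ∪ A') w (P + Q) := by
  classical
  obtain ⟨t, rfl, rfl⟩ := h
  obtain ⟨t', rfl, rfl⟩ := h'
  exact ⟨t ∪ t', Finset.coe_union t t', Finset.sum_union (Finset.disjoint_coe.1 hd)⟩

theorem prod (h : HasGenFun A w P) (h' : HasGenFun B w' Q) :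
    HasGenFun (A ×ˢ B) (fun p => w p.1 + w' p.2) (P * Q) := by
  obtain ⟨t, rfl, rfl⟩ := h
  obtain ⟨t', rfl, rfl⟩ := h'
  refine ⟨t ×ˢ t', Finset.coe_product t t', ?_⟩
  rw [Finset.sum_mul_sum, Finset.sum_product]
  simp only [LaurentPolynomial.T_add]

theorem pi {ι : Type} [Fintype ι] [DecidableEq ι] {A : ι → Set α} {P : ι → LaurentPolynomial ℤ}
    (h : ∀ i, HasGenFun (A i) w (P i)) :
    HasGenFun {x : ι → α | ∀ i, x i ∈ A i} (fun x => ∑ i, w (x i)) (∏ i, P i) := by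
  choose t ht hP using h
  refine ⟨Fintype.piFinset t, ?_, ?_⟩
  · ext x
    simp [← ht]
  · simp only [← hP, T_sum]
    rw [Finset.prod_univ_sum]

end HasGenFun

theorem qBinom_eq_zero : ∀ n k : ℕ, n < k → qBinom n k = 0
  | _, 0, h => absurd h (Nat.not_lt_zero _)
  | 0, _ + 1, _ => by rw [qBinom]
  | n + 1, k + 1, h => by
    rw [qBinom, qBinom_eq_zero n k (by omega), qBinom_eq_zero n (k + 1) (by omega)]
    simp

theorem qBinom_zero_right (n : ℕ) : qBinom n 0 = 1 := by
  cases n <;> rw [qBinom]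

/-- The partitions contained in an `m × n` rectangle, padded with zeros to `m` entries. -/
def rectangle (m : ℕ) (n : ℤ) : Set (Multiset ℤ) :=
  {Y | Multiset.card Y = m ∧ ∀ r ∈ Y, 0 ≤ r ∧ r ≤ n}

theorem bijOn_cons_zero (m : ℕ) {n : ℤ} (hn : 0 ≤ n) :
    Set.BijOn (fun Y => (0 : ℤ) ::ₘ Y) (rectangle m n) {Y | Y ∈ rectangle (m + 1) n ∧ 0 ∈ Y} := by
  refine ⟨fun Y hY => ⟨⟨by simp [hY.1], fun r hr => ?_⟩, Multiset.mem_cons_self _ _⟩,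
    fun Y _ Y' _ h => (Multiset.cons_inj_right 0).1 h, fun Y hY => ?_⟩
  · rcases Multiset.mem_cons.1 hr with rfl | hr
    · exact ⟨le_rfl, hn⟩
    · exact hY.2 r hr
  · obtain ⟨Z, rfl⟩ := Multiset.exists_cons_of_mem hY.2
    exact ⟨Z, ⟨by simpa using hY.1.1, fun r hr => hY.1.2 r (Multiset.mem_cons_of_mem hr)⟩, rfl⟩

theorem bijOn_map_add_one (m : ℕ) (n : ℤ) :
    Set.BijOn (fun Y : Multiset ℤ => Y.map (· + 1)) (rectangle m n)
      {Y | Y ∈ rectangle m (n + 1) ∧ 0 ∉ Y} := by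
  refine ⟨fun Y hY => ⟨⟨by simp [hY.1], fun r hr => ?_⟩, fun h0 => ?_⟩,
    fun Y _ Y' _ h => Multiset.map_injective (add_left_injective (1 : ℤ)) h, fun Y hY => ?_⟩
  · obtain ⟨s, hs, rfl⟩ := Multiset.mem_map.1 hr
    have := hY.2 s hs
    omega
  · obtain ⟨s, hs, h⟩ := Multiset.mem_map.1 h0
    have := hY.2 s hs
    omega
  · refine ⟨Y.map (· - 1), ⟨by simp [hY.1.1], fun r hr => ?_⟩, ?_⟩
    · obtain ⟨s, hs, rfl⟩ := Multiset.mem_map.1 hr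
      have h1 := hY.1.2 s hs
      have h2 : s ≠ 0 := fun h => hY.2 (h ▸ hs)
      omega
    · simp [Multiset.map_map]

/-- The `q`-Pascal recursion splits the partitions according to whether they have a zero entry. -/
theorem hasGenFun_rectangle (m n : ℕ) :
    HasGenFun (rectangle m n) Multiset.sum (qBinom (n + m) m) := by
  induction m generalizing n with
  | zero =>
    refine ⟨{0}, ?_, ?_⟩
    · ext Y
      simp only [Finset.coe_singleton, Set.mem_singleton_iff, rectangle, Set.mem_ofPred_eq,
        Multiset.card_eq_zero]
      exact ⟨fun h => ⟨h, by simp [h]⟩, fun h => h.1⟩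
    · rw [qBinom_zero_right]
      simp
  | succ m ihm =>
    have hzero : ∀ n : ℕ, HasGenFun {Y | Y ∈ rectangle (m + 1) n ∧ 0 ∈ Y} Multiset.sum
        (qBinom (n + m) m) := by
      intro n
      have := (ihm n).of_bijOn (bijOn_cons_zero m (Nat.cast_nonneg n)) (w' := Multiset.sum) (c := 0)
        fun Y _ => by simp
      simpa using this
    induction n with
    | zero =>
      have h : {Y | Y ∈ rectangle (m + 1) ((0 : ℕ) : ℤ) ∧ 0 ∈ Y} =
          rectangle (m + 1) ((0 : ℕ) : ℤ) := by
        ext Y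
        refine ⟨fun h => h.1, fun h => ⟨h, ?_⟩⟩
        obtain ⟨r, hr⟩ := Multiset.card_pos_iff_exists_mem.1 (h.1.symm ▸ Nat.succ_pos m : 0 < Multiset.card Y)
        have := h.2 r hr
        obtain rfl : r = 0 := by
          push_cast at this
          omega
        exact hr
      have := hzero 0
      rw [h] at this
      rw [zero_add] at this ⊢
      rw [qBinom, qBinom_eq_zero m (m + 1) (Nat.lt_succ_self m), mul_zero, add_zero]
      exact this
    | succ n ihn =>
      have h1 : HasGenFun {Y | Y ∈ rectangle (m + 1) ((n + 1 : ℕ) : ℤ) ∧ 0 ∉ Y} Multiset.sum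
          (LaurentPolynomial.T ((m : ℤ) + 1) * qBinom (n + (m + 1)) (m + 1)) := by
        rw [Nat.cast_succ]
        refine ihn.of_bijOn (bijOn_map_add_one (m + 1) n) fun Y hY => ?_
        rw [Multiset.sum_map_add, Multiset.map_id', Multiset.map_const', Multiset.sum_replicate, hY.1]
        ring
      have h2 : {Y | Y ∈ rectangle (m + 1) ((n + 1 : ℕ) : ℤ) ∧ 0 ∈ Y} ∪
          {Y | Y ∈ rectangle (m + 1) ((n + 1 : ℕ) : ℤ) ∧ 0 ∉ Y} =
          rectangle (m + 1) ((n + 1 : ℕ) : ℤ) := by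
        ext Y
        simp only [Set.mem_union, Set.mem_ofPred_eq]
        tauto
      have h3 := (hzero (n + 1)).union h1
        (Set.disjoint_left.2 fun Y hY hY' => hY'.2 hY.2)
      rw [h2] at h3
      rw [show n + 1 + (m + 1) = (n + 1 + m) + 1 by ring, qBinom]
      rwa [show n + (m + 1) = n + 1 + m by ring] at h3

/-- The riggings of a partition `μ` whose rows of length `i` have riggings between `0` and `p i`. -/
def riggings (μ : Multiset ℕ) (p : ℕ → ℤ) : Set (Multiset (ℕ × ℤ)) :=
  {X | X.map Prod.fst = μ ∧ ∀ s ∈ X, 0 ≤ s.2 ∧ s.2 ≤ p s.1}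

theorem bijOn_riggings {i : ℕ} {μ : Multiset ℕ} (hi : i ∉ μ) (m : ℕ) (p : ℕ → ℤ) :
    Set.BijOn (fun z : Multiset ℤ × Multiset (ℕ × ℤ) => z.1.map (fun r => (i, r)) + z.2)
      (rectangle m (p i) ×ˢ riggings μ p) (riggings (Multiset.replicate m i + μ) p) := by
  have hinj : Function.Injective fun r : ℤ => (i, r) := fun r s h => (Prod.ext_iff.1 h).2
  have hfilter : ∀ (Y : Multiset ℤ) (X : Multiset (ℕ × ℤ)), X ∈ riggings μ p →
      (Y.map (fun r => (i, r)) + X).filter (fun s => s.1 = i) = Y.map fun r => (i, r) := by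
    intro Y X hX
    have h1 : X.filter (fun s => s.1 = i) = 0 := by
      refine Multiset.filter_eq_nil.2 fun s hs h => hi ?_
      rw [← h, ← hX.1]
      exact Multiset.mem_map_of_mem _ hs
    rw [Multiset.filter_add, h1, add_zero, Multiset.filter_eq_self]
    intro s hs
    obtain ⟨r, -, rfl⟩ := Multiset.mem_map.1 hs
    rfl
  refine ⟨fun z hz => ⟨?_, fun s hs => ?_⟩, fun z hz z' hz' h => ?_, fun X hX => ?_⟩
  · simp only [Multiset.map_add, Multiset.map_map, hz.2.1, Function.comp_def, Multiset.map_const',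
      hz.1.1]
  · rcases Multiset.mem_add.1 hs with hs | hs
    · obtain ⟨r, hr, rfl⟩ := Multiset.mem_map.1 hs
      exact hz.1.2 r hr
    · exact hz.2.2 s hs
  · simp only at h
    have h1 := congrArg (Multiset.filter fun s => s.1 = i) h
    rw [hfilter _ _ hz.2, hfilter _ _ hz'.2] at h1
    rw [h1] at h
    exact Prod.ext (Multiset.map_injective hinj h1) (add_left_cancel h)
  · have hY : ((X.filter fun s => s.1 = i).map Prod.snd).map (fun r => (i, r)) =
        X.filter fun s => s.1 = i := by
      rw [Multiset.map_map]
      conv_rhs => rw [← Multiset.map_id (X.filter fun s => s.1 = i)]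
      refine Multiset.map_congr rfl fun s hs => ?_
      exact Prod.ext (Multiset.mem_filter.1 hs).2.symm rfl
    refine ⟨((X.filter fun s => s.1 = i).map Prod.snd, X.filter fun s => ¬ s.1 = i),
      ⟨⟨?_, fun r hr => ?_⟩, ?_, fun s hs => hX.2 s (Multiset.mem_filter.1 hs).1⟩, ?_⟩
    · have h1 : (X.map Prod.fst).count i = m := by
        rw [hX.1, Multiset.count_add, Multiset.count_replicate_self,
          Multiset.count_eq_zero_of_notMem hi, add_zero]
      rw [Multiset.card_map, ← h1, Multiset.count_map]
      simp only [eq_comm]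
    · obtain ⟨s, hs, rfl⟩ := Multiset.mem_map.1 hr
      obtain ⟨h1, h2⟩ := Multiset.mem_filter.1 hs
      rw [← h2]
      exact hX.2 s h1
    · have h1 := Multiset.filter_map (p := fun j => ¬ j = i) Prod.fst X
      rw [hX.1, Multiset.filter_add] at h1
      rw [Multiset.filter_eq_nil.2, Multiset.filter_eq_self.2, zero_add] at h1
      · exact h1.symm
      · exact fun j hj h => hi (h ▸ hj)
      · exact fun j hj h => h (Multiset.eq_of_mem_replicate hj)
    · simp only [hY]
      exact Multiset.filter_add_not _ _

theorem hasGenFun_riggings (μ : Multiset ℕ) (p : ℕ → ℤ) (hp : ∀ i ∈ μ, 0 ≤ p i) :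
    HasGenFun (riggings μ p) (fun X => (X.map Prod.snd).sum)
      (∏ i ∈ μ.toFinset, qBinom ((p i).toNat + μ.count i) (μ.count i)) := by
  classical
  induction hF : μ.toFinset using Finset.induction_on generalizing μ with
  | empty =>
    rw [Multiset.toFinset_eq_empty] at hF
    subst hF
    refine ⟨{0}, ?_, by simp⟩
    ext X
    simp only [Finset.coe_singleton, Set.mem_singleton_iff, riggings, Set.mem_ofPred_eq,
      Multiset.map_eq_zero]
    exact ⟨fun h => ⟨h, by simp [h]⟩, fun h => h.1⟩
  | insert i F hi ih =>
    have hiμ : i ∈ μ := by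
      rw [← Multiset.mem_toFinset, hF]
      exact Finset.mem_insert_self i F
    have hμ : Multiset.replicate (μ.count i) i + μ.filter (fun j => ¬ j = i) = μ := by
      rw [← Multiset.filter_eq' μ i]
      exact Multiset.filter_add_not _ _
    have hnot : i ∉ μ.filter (fun j => ¬ j = i) := by simp
    have hF' : (μ.filter (fun j => ¬ j = i)).toFinset = F := by
      rw [Multiset.toFinset_filter, hF, Finset.filter_insert, if_neg (by simp)]
      exact Finset.filter_true_of_mem fun j hj h => hi (h ▸ hj)
    have h1 := ih (μ.filter fun j => ¬ j = i)
      (fun j hj => hp j (Multiset.mem_filter.1 hj).1) hF'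
    have h2 := hasGenFun_rectangle (μ.count i) (p i).toNat
    rw [Int.toNat_of_nonneg (hp i hiμ)] at h2
    have h3 := (h2.prod h1).of_bijOn (bijOn_riggings hnot (μ.count i) p)
      (w' := fun X => (X.map Prod.snd).sum) (c := 0) fun z _ => by
        simp [Multiset.map_map]
    rw [hμ, LaurentPolynomial.T_zero, one_mul] at h3
    rw [Finset.prod_insert hi]
    convert h3 using 3 with j hj
    have : j ≠ i := fun h => hi (h ▸ hj)
    rw [Multiset.count_filter, if_pos this]

theorem shape_image (lam : Weight) (L : ℕ) : shape '' riggedConfigs lam L = configs lam L := by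
  ext ν
  constructor
  · rintro ⟨x, hx, rfl⟩
    exact hx.1
  · intro hν
    have hs : shape (fun a => (ν a).map fun i => (i, 0)) = ν := by
      funext a
      exact map_fst_graph (fun _ => 0) (ν a)
    refine ⟨fun a => (ν a).map fun i => (i, 0), ⟨by rw [hs]; exact hν, fun a s hs' => ?_⟩, hs⟩
    rw [hs]
    obtain ⟨i, hi, rfl⟩ := Multiset.mem_map.1 hs'
    exact ⟨le_rfl, hν.2.2 a i (hν.1 a i hi)⟩

theorem riggedConfigs_finite {lam : Weight} (hlam : Dominant lam) (L : ℕ) :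
    (riggedConfigs lam L).Finite :=
  (bijOn_Phi L hlam).finite_iff_finite.2 (Set.toFinite _)

theorem configs_finite {lam : Weight} (hlam : Dominant lam) (L : ℕ) :
    (configs lam L).Finite := by
  rw [← shape_image]
  exact (riggedConfigs_finite hlam L).image _

theorem finsum_riggings {lam : Weight} {L : ℕ} {ν : Config} (hν : ν ∈ configs lam L) :
    ∑ᶠ x ∈ {x | x ∈ riggedConfigs lam L ∧ shape x = ν},
      (LaurentPolynomial.T (riggedCharge L x) : LaurentPolynomial ℤ) =
    LaurentPolynomial.T (charge L ν) * ∏ a, ∏ i ∈ (ν a).toFinset,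
      qBinom ((vacancy L ν a i).toNat + (ν a).count i) ((ν a).count i) := by
  have h1 := HasGenFun.pi fun a => hasGenFun_riggings (ν a) (vacancy L ν a)
    fun i hi => hν.2.2 a i (hν.1 a i hi)
  have h2 : {x : Rigged | ∀ a, x a ∈ riggings (ν a) (vacancy L ν a)} =
      {x | x ∈ riggedConfigs lam L ∧ shape x = ν} := by
    ext x
    constructor
    · intro hx
      have hs : shape x = ν := funext fun a => (hx a).1
      exact ⟨⟨by rw [hs]; exact hν, fun a s h => by rw [hs]; exact (hx a).2 s h⟩, hs⟩
    · rintro ⟨hx, rfl⟩ a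
      exact ⟨rfl, hx.2 a⟩
  rw [h2] at h1
  refine (h1.of_bijOn (Set.bijOn_id _) (w' := riggedCharge L) fun x hx => ?_).finsum_eq
  rw [id, riggedCharge, hx.2]

theorem oneDimSum_eq_fermionic {lam : Weight} (hlam : Dominant lam) (L : ℕ) :
    oneDimSum lam L = fermionic lam L := by
  have h1 : oneDimSum lam L = ∑ᶠ x ∈ riggedConfigs lam L, LaurentPolynomial.T (riggedCharge L x) :=
    (finsum_mem_eq_of_bijOn (Phi L) (bijOn_Phi L hlam) fun x hx => by
      rw [(riggedCharge_eq_energy hx).1]).symm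
  have h2 : riggedConfigs lam L =
      ⋃ ν ∈ configs lam L, {x | x ∈ riggedConfigs lam L ∧ shape x = ν} := by
    ext x
    simp only [Set.mem_iUnion, Set.mem_ofPred_eq, exists_prop]
    exact ⟨fun h => ⟨shape x, h.1, h, rfl⟩, fun ⟨_, _, h, _⟩ => h⟩
  rw [h1, h2, finsum_mem_biUnion]
  · exact finsum_mem_congr rfl fun ν hν => finsum_riggings hν
  · intro ν _ ν' _ hne
    exact Set.disjoint_left.2 fun x hx hx' => hne (hx.2.symm.trans hx'.2)
  · exact configs_finite hlam L
  · exact fun ν _ => (riggedConfigs_finite hlam L).subset fun x hx => hx.1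

end E6KKR

theorem theorem3p1 :
    -- `γ` and `δ` are well defined, independently of the choices in the algorithm, and `δ` is a
    -- bijection from `RC_b(λ, L + 1)` to `RC(λ - wt(b), L)`
    (∀ (L : ℕ) (lam : E6KKR.Weight), E6KKR.Dominant lam →
      (∀ x ∈ E6KKR.riggedConfigs lam (L + 1),
        (∃! r : E6KKR.Box × E6KKR.Rigged, E6KKR.Outcome L x r.1 r.2) ∧
        E6KKR.Dominant (lam - E6KKR.boxWt (E6KKR.gammaDelta L x).1)) ∧
      ∀ b : E6KKR.Box,
        Set.BijOn (fun x => (E6KKR.gammaDelta L x).2)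
          {x | x ∈ E6KKR.riggedConfigs lam (L + 1) ∧ (E6KKR.gammaDelta L x).1 = b}
          (E6KKR.riggedConfigs (lam - E6KKR.boxWt b) L)) ∧
    -- `Φ` is a statistic-preserving bijection, and `X = M`
    (∀ (L : ℕ) (lam : E6KKR.Weight), E6KKR.Dominant lam →
      Set.BijOn (E6KKR.Phi L) (E6KKR.riggedConfigs lam L) (E6KKR.paths lam L) ∧
      (∀ x ∈ E6KKR.riggedConfigs lam L,
        E6KKR.riggedCharge L x = E6KKR.energy (E6KKR.Phi L x)) ∧
      (E6KKR.configs lam L).Finite ∧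
      E6KKR.oneDimSum lam L = E6KKR.fermionic lam L) := by
  refine ⟨fun L lam hlam => ⟨fun x hx => ⟨E6KKR.existsUnique_outcome L x, ?_⟩,
    fun b => E6KKR.bijOn_delta hlam b⟩, fun L lam hlam => ⟨E6KKR.bijOn_Phi L hlam,
    fun x hx => (E6KKR.riggedCharge_eq_energy hx).1, E6KKR.configs_finite hlam L,
    E6KKR.oneDimSum_eq_fermionic hlam L⟩⟩
  exact E6KKR.dominant_of_mem ((E6KKR.bijOn_delta hlam _).mapsTo ⟨hx, rfl⟩)
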